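/- \textbf{Setting.} Let $p\in(0,1)$, $q=1-p$, let $(E,\mathcal B)$ be a measurable space (for instance a subset of $\mathbb R$ with its Borel sets) with a $\sigma$-finite measure $\mu$, and let $f^0_x(y)$, $f^1_x(y)$ be two jointly measurable functions with values in $[0,\infty)$ such that $\int_E f^i_x(y)\,\mu(dy)=1$ for all $x\in E$, $i=0,1$; they are the transition densities of two homogeneous Markov processes. Assume that for every $x$, $f^1_x(y)=0$ for $\mu$-almost every $y$ with $f^0_x(y)=0$. Fix $x\in E$ and $d\in\{0,1,2,\dots\}$. On a probability space with probability $P_x$ let $\theta$ and $(X_n)_{n\ge 0}$ be random variables such that $P_x(\theta=j)=p^{j-1}q$ for $j\ge1$, $X_0=x$ almost surely, and, for all $n\ge 0$, given $(\theta,X_0,\dots,X_n)$ the variable $X_{n+1}$ has $\mu$-density $f^0_{X_n}$ on $\{\theta>n+1\}$ and $f^1_{X_n}$ on $\{\theta\le n+1\}$. Thus $X$ follows the first Markov process before the disorder time $\theta$, and from time $\theta$ on the second one, started from $X_{\theta-1}$. Let $\mathcal F_n=\sigma(X_0,\dots,X_n)$. Stopping times are taken with respect to $(\mathcal F_n)$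 and may take the value $\infty$; the event $|\theta-\tau|\le d$ does not occur where $\tau=\infty$. For $x_k,\dots,x_n\in E$ and $0\le m\le n-k$ put $$L_m(x_k,\dots,x_n)=\prod_{r=k+1}^{n-m}f^0_{x_{r-1}}(x_r)\prod_{r=n-m+1}^{n}f^1_{x_{r-1}}(x_r),$$ with empty products equal to $1$, and for $x_1,\dots,x_{d+2}\in E$ put $$\Lambda(x_1,\dots,x_{d+2})=1-p^d+q\sum_{m=1}^{d+1}\frac{L_m(x_1,\dots,x_{d+2})}{p^mL_0(x_1,\dots,x_{d+2})}.$$ Define recursively, with values in $[0,\infty]$ (conventions $a/0=\infty$ for $a>0$, $0/0=0$, $0\cdot\infty=0$), $$r_0(x_1,\dots,x_{d+1})=p\Big[1-p^d+q\sum_{m=1}^{d+1}\frac{L_{m-1}(x_1,\dots,x_{d+1})}{p^mL_0(x_1,\dots,x_{d+1})}\Big],$$ $$r_k(x_1,\dots,x_{d+1})=p\int_E f^0_{x_{d+1}}(y)\max\{\Lambda(x_1,\dots,x_{d+1},y);\,r_{k-1}(x_2,\dots,x_{d+1},y)\}\,\mu(dy),\quad k\ge1.$$ \textbf{Theorem.}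 The limit $r^*=\lim_{k\to\infty}r_k$ exists at every point of $E^{d+1}$, and it is finite at every point where $L_0\ne0$. Moreover: (a) The random time $$\tau^*=\inf\{n\ge d+1:\ \Lambda(X_{n-d-1},\dots,X_n)\ge r^*(X_{n-d},\dots,X_n)\}\qquad(\inf\emptyset=\infty)$$ is a stopping time, and $P_x(|\theta-\tau^*|\le d)=\sup_\tau P_x(|\theta-\tau|\le d)$, where the supremum is over all stopping times $\tau$. (b) The optimal value is $$P_x(|\theta-\tau^*|\le d)=p^{d+1}\int_{E^{d+1}}\max\{\Lambda(x,x_1,\dots,x_{d+1});\,r^*(x_1,\dots,x_{d+1})\}\,L_0(x,x_1,\dots,x_{d+1})\,\mu(dx_1)\cdots\mu(dx_{d+1}).$$ -/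

import Mathlib

open MeasureTheory Filter Topology
open scoped ENNReal NNReal

namespace DisorderDetection

/-- `f x y` is a (jointly measurable) transition density of a homogeneous Markov process with
respect to the reference measure `μ`: for every state `x`, `f x ·` is a probability density. -/
structure IsTransitionDensity {E : Type*} [MeasurableSpace E] (μ : Measure E)
    (f : E → E → ℝ≥0) : Prop where
  measurable : Measurable (Function.uncurry f)
  lintegral_eq_one : ∀ x, ∫⁻ y, (f x y : ℝ≥0∞) ∂μ = 1

/-- Law of the pair `(θ, X)` under `P = P_x`: the time `θ` is geometric on `{1, 2, …}`, the observed
sequence starts at `x`, and, given `θ` and `X 0, …, X n`, the next observation `X (n + 1)` has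
density `f0 (X n) ·` when `n + 1 < θ` and density `f1 (X n) ·` when `θ ≤ n + 1`. Thus `X` follows
the first Markov process before `θ`, and from time `θ` on the second one, started
from the state `X (θ - 1)`. -/
structure IsSwitchedProcess {E Ω : Type*} [MeasurableSpace E] [MeasurableSpace Ω]
    (P : Measure Ω) (μ : Measure E) (p q : ℝ≥0) (f0 f1 : E → E → ℝ≥0) (x : E)
    (θ : Ω → ℕ) (X : ℕ → Ω → E) : Prop where
  measurable_time : Measurable θ
  geometric : ∀ j : ℕ, 1 ≤ j → P {ω | θ ω = j} = ((p ^ (j - 1) * q : ℝ≥0) : ℝ≥0∞)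
  start : ∀ᵐ ω ∂P, X 0 ω = x
  transition : ∀ (n j : ℕ) (B : Set (Fin (n + 1) → E)) (A : Set E),
    MeasurableSet B → MeasurableSet A →
      P {ω | θ ω = j ∧ (fun i : Fin (n + 1) => X i ω) ∈ B ∧ X (n + 1) ω ∈ A} =
        ∫⁻ ω in {ω | θ ω = j ∧ (fun i : Fin (n + 1) => X i ω) ∈ B},
          (∫⁻ y in A, ((if n + 1 < j then f0 (X n ω) y else f1 (X n ω) y : ℝ≥0) : ℝ≥0∞) ∂μ) ∂P

/-- The filtration `F n = σ(X 0, …, X n)` of the observations. -/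
def observed {E Ω : Type*} [MeasurableSpace E] [mΩ : MeasurableSpace Ω] (X : ℕ → Ω → E)
    (hX : ∀ n, Measurable (X n)) : Filtration ℕ mΩ where
  seq n := ⨆ j ≤ n, MeasurableSpace.comap (X j) inferInstance
  mono' := fun _ _ hmn => iSup₂_mono' fun j hj => ⟨j, hj.trans hmn, le_rfl⟩
  le' := fun _ => iSup₂_le fun j _ => (hX j).comap_le

/-- `L_m(x_0, …, x_N)`: the product of the `N` transition densities along `x_0, …, x_N`, where the
last `m` transitions use `f1` and the earlier ones `f0`. -/
noncomputable def L {E : Type*} (f0 f1 : E → E → ℝ≥0) {N : ℕ} (m : ℕ) (x : Fin (N + 1) → E) :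
    ℝ≥0 :=
  ∏ r : Fin N, if (r : ℕ) + m < N then f0 (x r.castSucc) (x r.succ)
    else f1 (x r.castSucc) (x r.succ)

/-- `1 - p^d + q ∑_{m=1}^{d+1} L_m(x) / (p^m L_0(x))` for a window `x` of `d + 2` states. -/
noncomputable def statistic {E : Type*} (p q : ℝ≥0) (f0 f1 : E → E → ℝ≥0) (d : ℕ)
    (x : Fin (d + 2) → E) : ℝ≥0∞ :=
  1 - (p : ℝ≥0∞) ^ d +
    q * ∑ m ∈ Finset.Icc 1 (d + 1), (L f0 f1 m x : ℝ≥0∞) / ((p : ℝ≥0∞) ^ m * L f0 f1 0 x)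

/-- The thresholds `r_k` on windows of `d + 1` states. In the recursion, `Fin.snoc x y` is the window
`x` followed by the new state `y`, and `Fin.tail` deletes the oldest state. -/
noncomputable def threshold {E : Type*} [MeasurableSpace E] (μ : Measure E) (p q : ℝ≥0)
    (f0 f1 : E → E → ℝ≥0) (d : ℕ) : ℕ → (Fin (d + 1) → E) → ℝ≥0∞
  | 0, x => p * (1 - (p : ℝ≥0∞) ^ d +
      q * ∑ m ∈ Finset.Icc 1 (d + 1),
        (L f0 f1 (m - 1) x : ℝ≥0∞) / ((p : ℝ≥0∞) ^ m * L f0 f1 0 x))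
  | k + 1, x => p * ∫⁻ y, (f0 (x (Fin.last d)) y : ℝ≥0∞) *
      max (statistic p q f0 f1 d (Fin.snoc (α := fun _ => E) x y))
        (threshold μ p q f0 f1 d k (Fin.tail (Fin.snoc (α := fun _ => E) x y))) ∂μ

/-- The limit `r* = lim_k r_k`. -/
noncomputable def rStar {E : Type*} [MeasurableSpace E] (μ : Measure E) (p q : ℝ≥0)
    (f0 f1 : E → E → ℝ≥0) (d : ℕ) (x : Fin (d + 1) → E) : ℝ≥0∞ :=
  limUnder atTop (fun k : ℕ => threshold μ p q f0 f1 d k x)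

/-- The rule `τ*`: the first `n ≥ d + 1` at which the statistic of `X_{n-d-1}, …, X_n` is at least
`r*(X_{n-d}, …, X_n)`, and `∞` if there is no such `n`. -/
noncomputable def tauStar {E Ω : Type*} [MeasurableSpace E] (μ : Measure E) (p q : ℝ≥0)
    (f0 f1 : E → E → ℝ≥0) (d : ℕ) (X : ℕ → Ω → E) (ω : Ω) : ℕ∞ :=
  sInf {t : ℕ∞ | ∃ n : ℕ, t = n ∧ d + 1 ≤ n ∧
    rStar μ p q f0 f1 d (fun i => X (n - d + i) ω) ≤
      statistic p q f0 f1 d (fun i => X (n - (d + 1) + i) ω)}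

/-- The event `|θ - τ| ≤ d`; it does not occur where `τ = ∞`. -/
def detection {Ω : Type*} (d : ℕ) (θ : Ω → ℕ) (τ : Ω → ℕ∞) : Set Ω :=
  {ω | ∃ n : ℕ, τ ω = n ∧ |(θ ω : ℤ) - n| ≤ d}

end DisorderDetection

/-! Everything is integrated over the survival event `{n < θ}`. There the history up to time `n` has
density `p ^ n * L_0` (`lintegral_history_lt`), and, `θ` being memoryless, `q * ratio m` is the
density of the law of the history on `{θ = n + 1 - m}` relative to its law on `{n < θ}`
(`lintegral_history_mul_ratio`). Hence `statistic` is the posterior probability of `|θ - n| ≤ d`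
divided by that of `n < θ`. The oldest `f0` factors cancel in the ratios, so the last `d + 2` states
suffice.

On survival, one time step acts as `p` times the `f0` kernel, so the problem is an optimal stopping
problem for this kernel with reward `statistic`. The thresholds increase, and their limit solves the
Bellman equation (`rStar_eq_lintegral`): `r*` is the value of continuing. Telescoping
`detection_add_continuation` bounds every rule that starts at time `d + 1` by the integral of
`value` at that time. For `τ*` every step is an equality, and the remainder vanishes because `r*` is
at most the odds that detection is still possible later (`rStar_le`, `lintegral_rStar_le`). Starting
at `d + 1` costs nothing since `θ ≥ 1`, and the density of the history at time `d + 1` turns the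
bound into the integral in (b). -/

namespace DisorderDetection

/-! ### Algebra of likelihood ratios. -/

section Deterministic

variable {E : Type*} [MeasurableSpace E] {μ : Measure E} {p q : ℝ≥0} {f0 f1 : E → E → ℝ≥0}

/-- The likelihood ratio `L_m(x) / (p^m L_0(x))`. -/
noncomputable def ratio (p : ℝ≥0) (f0 f1 : E → E → ℝ≥0) {N : ℕ} (m : ℕ) (x : Fin (N + 1) → E) :
    ℝ≥0∞ :=
  (L f0 f1 m x : ℝ≥0∞) / ((p : ℝ≥0∞) ^ m * L f0 f1 0 x)

omit [MeasurableSpace E] in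
lemma L_succ_snoc {N : ℕ} (m : ℕ) (w : Fin (N + 1) → E) (y : E) :
    L f0 f1 (m + 1) (Fin.snoc (α := fun _ => E) w y) = L f0 f1 m w * f1 (w (Fin.last N)) y := by
  unfold L
  rw [Fin.prod_univ_castSucc]
  congr 1
  · refine Finset.prod_congr rfl fun i _ => ?_
    have h : ((i.castSucc : Fin (N + 1)) : ℕ) + (m + 1) < N + 1 ↔ (i : ℕ) + m < N := by
      simp; omega
    simp only [h, Fin.succ_castSucc, Fin.snoc_castSucc]
  · simp

omit [MeasurableSpace E] in
lemma L_zero_snoc {N : ℕ} (w : Fin (N + 1) → E) (y : E) :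
    L f0 f1 0 (Fin.snoc (α := fun _ => E) w y) = L f0 f1 0 w * f0 (w (Fin.last N)) y := by
  unfold L
  rw [Fin.prod_univ_castSucc]
  congr 1
  · refine Finset.prod_congr rfl fun i _ => ?_
    have h : ((i.castSucc : Fin (N + 1)) : ℕ) + 0 < N + 1 := by simp
    have h' : (i : ℕ) + 0 < N := by simp
    simp only [h, h', Fin.succ_castSucc, Fin.snoc_castSucc]
  · simp

omit [MeasurableSpace E] in
lemma L_eq_mul_tail {N m : ℕ} (hm : m ≤ N) (w : Fin (N + 2) → E) :
    L f0 f1 m w = f0 (w 0) (w 1) * L f0 f1 m (Fin.tail w) := by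
  unfold L
  rw [Fin.prod_univ_succ]
  congr 1
  · have h : ((0 : Fin (N + 1)) : ℕ) + m < N + 1 := by simp; omega
    simp only [h, if_true]
    rfl
  · refine Finset.prod_congr rfl fun i _ => ?_
    have h : ((i.succ : Fin (N + 1)) : ℕ) + m < N + 1 ↔ (i : ℕ) + m < N := by
      simp; omega
    simp only [h, Fin.tail]
    rfl

omit [MeasurableSpace E] in
lemma L_tail_ne_zero {N : ℕ} {w : Fin (N + 2) → E} (hw : L f0 f1 0 w ≠ 0) :
    L f0 f1 0 (Fin.tail w) ≠ 0 := by
  rw [L_eq_mul_tail (Nat.zero_le N)] at hw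
  exact right_ne_zero_of_mul hw

-- With `m ≤ N` the oldest of the `N + 1` transitions is an `f0` factor in both numerator and
-- denominator, and it cancels. This is why a bounded window carries all the needed information.
omit [MeasurableSpace E] in
lemma ratio_tail {N m : ℕ} (hm : m ≤ N) {w : Fin (N + 2) → E} (hw : L f0 f1 0 w ≠ 0) :
    ratio p f0 f1 m (Fin.tail w) = ratio p f0 f1 m w := by
  unfold ratio
  have hf : f0 (w 0) (w 1) ≠ 0 := by
    rw [L_eq_mul_tail (Nat.zero_le N)] at hw
    exact left_ne_zero_of_mul hw
  rw [L_eq_mul_tail hm w, L_eq_mul_tail (Nat.zero_le N) w, ENNReal.coe_mul, ENNReal.coe_mul,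
    mul_left_comm]
  exact (ENNReal.mul_div_mul_left _ _ (by simpa using hf) ENNReal.coe_ne_top).symm

omit [MeasurableSpace E] in
lemma ratio_zero {N : ℕ} {w : Fin (N + 1) → E} (hw : L f0 f1 0 w ≠ 0) :
    ratio p f0 f1 0 w = 1 := by
  unfold ratio
  rw [pow_zero, one_mul]
  exact ENNReal.div_self (by simpa using hw) ENNReal.coe_ne_top

omit [MeasurableSpace E] in
lemma ratio_ne_top (hp : 0 < p) {N : ℕ} (m : ℕ) {w : Fin (N + 1) → E} (hw : L f0 f1 0 w ≠ 0) :
    ratio p f0 f1 m w ≠ ∞ := by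
  refine ENNReal.div_ne_top ENNReal.coe_ne_top (mul_ne_zero (pow_ne_zero _ ?_) ?_)
  · simpa using hp.ne'
  · simpa using hw

-- A new state multiplies the ratio by `f1 / (p * f0)`; the identity is cleared of denominators.
-- Where `f0` vanishes the ratio may be `∞`, but `0 * ∞ = 0` and absolute continuity make both sides
-- `0`.
omit [MeasurableSpace E] in
lemma mul_ratio_succ_snoc (hp : 0 < p) {N : ℕ} (m : ℕ) (w : Fin (N + 1) → E) {y : E}
    (hy : f0 (w (Fin.last N)) y = 0 → f1 (w (Fin.last N)) y = 0) :
    (p : ℝ≥0∞) * ((f0 (w (Fin.last N)) y : ℝ≥0∞) *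
        ratio p f0 f1 (m + 1) (Fin.snoc (α := fun _ => E) w y)) =
      ratio p f0 f1 m w * f1 (w (Fin.last N)) y := by
  by_cases h : f0 (w (Fin.last N)) y = 0
  · simp [h, hy h]
  unfold ratio
  have hp' : (p : ℝ≥0∞) ≠ 0 := by simpa using hp.ne'
  have h' : (f0 (w (Fin.last N)) y : ℝ≥0∞) ≠ 0 := by simpa using h
  rw [L_succ_snoc, L_zero_snoc, ENNReal.coe_mul, ENNReal.coe_mul, pow_succ,
    show ∀ a b c e : ℝ≥0∞, a * b * (c * e) = (b * e) * (a * c) from fun a b c e => by ring,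
    ← mul_assoc, ← mul_div_assoc,
    ENNReal.mul_div_mul_left _ _ (mul_ne_zero hp' h')
      (ENNReal.mul_ne_top ENNReal.coe_ne_top ENNReal.coe_ne_top),
    ENNReal.mul_div_right_comm]

/-! ### Measurability of the statistic and the thresholds. -/

section Measurability

lemma IsTransitionDensity.measurable_comp (hf : IsTransitionDensity μ f0) {α : Type*}
    [MeasurableSpace α] {a b : α → E} (ha : Measurable a) (hb : Measurable b) :
    Measurable fun t => f0 (a t) (b t) :=
  hf.measurable.comp (ha.prodMk hb)

lemma measurable_L (hf0 : IsTransitionDensity μ f0) (hf1 : IsTransitionDensity μ f1)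
    {N : ℕ} (m : ℕ) : Measurable (L f0 f1 (N := N) m) := by
  unfold L
  refine Finset.measurable_prod _ fun r _ => ?_
  split_ifs
  · exact hf0.measurable_comp (measurable_pi_apply _) (measurable_pi_apply _)
  · exact hf1.measurable_comp (measurable_pi_apply _) (measurable_pi_apply _)

lemma measurable_ratio (hf0 : IsTransitionDensity μ f0) (hf1 : IsTransitionDensity μ f1)
    {N : ℕ} (m : ℕ) : Measurable (ratio p f0 f1 (N := N) m) :=
  (measurable_L hf0 hf1 m).coe_nnreal_ennreal.div
    ((measurable_L hf0 hf1 0).coe_nnreal_ennreal.const_mul _)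

lemma measurable_statistic (hf0 : IsTransitionDensity μ f0) (hf1 : IsTransitionDensity μ f1)
    (d : ℕ) : Measurable (statistic p q f0 f1 d) :=
  measurable_const.add ((Finset.measurable_sum _ fun m _ => measurable_ratio hf0 hf1 m).const_mul _)

lemma measurable_snoc {N : ℕ} {α : Type*} [MeasurableSpace α] {w : α → Fin N → E} {y : α → E}
    (hw : Measurable w) (hy : Measurable y) :
    Measurable fun t => (Fin.snoc (α := fun _ => E) (w t) (y t) : Fin (N + 1) → E) := by
  refine measurable_pi_lambda _ fun i => ?_
  refine Fin.lastCases ?_ (fun i => ?_) i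
  · simpa using hy
  · simpa [Function.comp_def] using (measurable_pi_apply i).comp hw

lemma measurable_tail {N : ℕ} : Measurable (Fin.tail : (Fin (N + 1) → E) → Fin N → E) :=
  measurable_pi_lambda _ fun i => measurable_pi_apply i.succ

lemma measurable_init {N : ℕ} : Measurable (Fin.init : (Fin (N + 1) → E) → Fin N → E) :=
  measurable_pi_lambda _ fun i => measurable_pi_apply i.castSucc

lemma measurable_threshold [SFinite μ] (hf0 : IsTransitionDensity μ f0)
    (hf1 : IsTransitionDensity μ f1) (d k : ℕ) : Measurable (threshold μ p q f0 f1 d k) := by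
  induction k with
  | zero =>
    have h : ∀ m, Measurable fun x : Fin (d + 1) → E =>
        (L f0 f1 (m - 1) x : ℝ≥0∞) / ((p : ℝ≥0∞) ^ m * L f0 f1 0 x) := fun m =>
      (measurable_L hf0 hf1 _).coe_nnreal_ennreal.div
      ((measurable_L hf0 hf1 0).coe_nnreal_ennreal.const_mul _)
    exact Measurable.const_mul (measurable_const.add
      ((Finset.measurable_sum _ fun m _ => h m).const_mul _)) _
  | succ k ih =>
    have hs : Measurable fun t : (Fin (d + 1) → E) × E =>
        (Fin.snoc (α := fun _ => E) t.1 t.2 : Fin (d + 2) → E) :=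
      measurable_snoc measurable_fst measurable_snd
    refine Measurable.const_mul (Measurable.lintegral_prod_right' (f := fun t : (Fin (d + 1) → E) × E =>
      (f0 (t.1 (Fin.last d)) t.2 : ℝ≥0∞) *
      max (statistic p q f0 f1 d (Fin.snoc (α := fun _ => E) t.1 t.2))
        (threshold μ p q f0 f1 d k (Fin.tail (Fin.snoc (α := fun _ => E) t.1 t.2)))) ?_) _
    exact (hf0.measurable_comp ((measurable_pi_apply _).comp measurable_fst)
      measurable_snd).coe_nnreal_ennreal.mul
      (((measurable_statistic hf0 hf1 d).comp hs).max (ih.comp (measurable_tail.comp hs)))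

end Measurability

/-! ### Monotonicity, limit and finiteness of the thresholds. -/

omit [MeasurableSpace E] in
lemma statistic_eq (d : ℕ) (w : Fin (d + 2) → E) :
    statistic p q f0 f1 d w =
      1 - (p : ℝ≥0∞) ^ d + q * ∑ m ∈ Finset.range (d + 1), ratio p f0 f1 (m + 1) w := by
  rw [Finset.range_eq_Ico, Finset.sum_Ico_add' (fun m => ratio p f0 f1 m w)]
  rfl

lemma threshold_zero_eq (hp : 0 < p) (d : ℕ) (w : Fin (d + 1) → E) :
    threshold μ p q f0 f1 d 0 w =
      p * (1 - (p : ℝ≥0∞) ^ d) + q * ∑ m ∈ Finset.range (d + 1), ratio p f0 f1 m w := by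
  have hp' : (p : ℝ≥0∞) ≠ 0 := by simpa using hp.ne'
  rw [threshold, mul_add, mul_left_comm, Finset.mul_sum (Finset.Icc 1 (d + 1))]
  congr 2
  -- The outer factor `p` cancels one power in `p ^ m`, turning the `m`-th term into `ratio (m -
  -- 1)`.
  have := Finset.sum_Ico_add' (fun m => (p : ℝ≥0∞) *
    ((L f0 f1 (m - 1) w : ℝ≥0∞) / ((p : ℝ≥0∞) ^ m * L f0 f1 0 w))) 0 (d + 1) 1
  rw [Finset.range_eq_Ico]
  refine Eq.trans this.symm (Finset.sum_congr rfl fun m _ => ?_)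
  rw [Nat.add_sub_cancel, ratio, pow_succ', mul_assoc, ← mul_div_assoc,
    ENNReal.mul_div_mul_left _ _ hp' ENNReal.coe_ne_top]

variable (hf0 : IsTransitionDensity μ f0) (hf1 : IsTransitionDensity μ f1)
  (hac : ∀ y, ∀ᵐ z ∂μ, f0 y z = 0 → f1 y z = 0)

include hf0 hf1 hac

lemma lintegral_ratio_succ_snoc (hp : 0 < p) {N : ℕ} (m : ℕ) (w : Fin (N + 1) → E)
    {g : E → ℝ≥0∞} (hg : Measurable g) :
    (p : ℝ≥0∞) * ∫⁻ y, (f0 (w (Fin.last N)) y : ℝ≥0∞) *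
        (g y * ratio p f0 f1 (m + 1) (Fin.snoc (α := fun _ => E) w y)) ∂μ =
      ratio p f0 f1 m w * ∫⁻ y, (f1 (w (Fin.last N)) y : ℝ≥0∞) * g y ∂μ := by
  have h0 : Measurable fun y => (f0 (w (Fin.last N)) y : ℝ≥0∞) :=
    (hf0.measurable_comp measurable_const measurable_id).coe_nnreal_ennreal
  have h1 : Measurable fun y => (f1 (w (Fin.last N)) y : ℝ≥0∞) :=
    (hf1.measurable_comp measurable_const measurable_id).coe_nnreal_ennreal
  rw [← lintegral_const_mul, ← lintegral_const_mul _ (by fun_prop)]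
  · refine lintegral_congr_ae ?_
    filter_upwards [hac (w (Fin.last N))] with y hy
    rw [← mul_assoc (ratio p f0 f1 m w), ← mul_ratio_succ_snoc hp m w hy]
    ring
  · exact h0.mul (hg.mul ((measurable_ratio hf0 hf1 _).comp
      (measurable_snoc measurable_const measurable_id)))

/-- The one-step expectation, under the first process, of an affine combination of ratios. -/
lemma lintegral_affine_ratio (hp : 0 < p) {d : ℕ} (c : ℝ≥0∞) (w : Fin (d + 1) → E) :
    (p : ℝ≥0∞) * ∫⁻ y, (f0 (w (Fin.last d)) y : ℝ≥0∞) *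
        (c + q * ∑ m ∈ Finset.range (d + 1),
          ratio p f0 f1 (m + 1) (Fin.snoc (α := fun _ => E) w y)) ∂μ =
      p * c + q * ∑ m ∈ Finset.range (d + 1), ratio p f0 f1 m w := by
  have h0 : Measurable fun y => (f0 (w (Fin.last d)) y : ℝ≥0∞) :=
    (hf0.measurable_comp measurable_const measurable_id).coe_nnreal_ennreal
  have hr : ∀ m, Measurable fun y => (f0 (w (Fin.last d)) y : ℝ≥0∞) *
      ratio p f0 f1 (m + 1) (Fin.snoc (α := fun _ => E) w y) := fun m =>
    h0.mul ((measurable_ratio hf0 hf1 _).comp (measurable_snoc measurable_const measurable_id))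
  simp_rw [mul_add, mul_left_comm _ (q : ℝ≥0∞), Finset.mul_sum]
  rw [lintegral_add_left (h0.mul_const c), lintegral_mul_const _ h0, hf0.lintegral_eq_one, one_mul,
    mul_add, lintegral_finsetSum _ fun m _ => (hr m).const_mul _, Finset.mul_sum]
  congr 1
  refine Finset.sum_congr rfl fun m _ => ?_
  rw [lintegral_const_mul _ (hr m), mul_left_comm]
  have := lintegral_ratio_succ_snoc hf0 hf1 hac hp m w (g := fun _ => 1) measurable_const
  simp only [one_mul, mul_one, hf1.lintegral_eq_one] at this
  rw [this]

/-- So `r_0` is the value of stopping at the very next step, which gives `r_0 ≤ r_1` and starts the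
monotonicity induction. -/
lemma threshold_zero_eq_lintegral (hp : 0 < p) (d : ℕ) (w : Fin (d + 1) → E) :
    threshold μ p q f0 f1 d 0 w = p * ∫⁻ y, (f0 (w (Fin.last d)) y : ℝ≥0∞) *
      statistic p q f0 f1 d (Fin.snoc (α := fun _ => E) w y) ∂μ := by
  simp_rw [statistic_eq]
  rw [lintegral_affine_ratio hf0 hf1 hac hp, threshold_zero_eq hp]

lemma threshold_monotone (hp : 0 < p) (d : ℕ) : Monotone (threshold μ p q f0 f1 d) := by
  refine monotone_nat_of_le_succ fun k => ?_
  induction k with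
  | zero =>
    intro w
    rw [threshold_zero_eq_lintegral hf0 hf1 hac hp, threshold]
    gcongr
    exact le_max_left _ _
  | succ k ih =>
    intro w
    rw [threshold, threshold]
    gcongr
    exact ih _

lemma tendsto_threshold (hp : 0 < p) (d : ℕ) (w : Fin (d + 1) → E) :
    Tendsto (fun k => threshold μ p q f0 f1 d k w) atTop (𝓝 (⨆ k, threshold μ p q f0 f1 d k w)) :=
  tendsto_atTop_iSup fun _ _ h => threshold_monotone hf0 hf1 hac hp d h w

lemma rStar_eq_iSup (hp : 0 < p) (d : ℕ) (w : Fin (d + 1) → E) :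
    rStar μ p q f0 f1 d w = ⨆ k, threshold μ p q f0 f1 d k w :=
  (tendsto_threshold hf0 hf1 hac hp d w).limUnder_eq

lemma measurable_rStar [SFinite μ] (hp : 0 < p) (d : ℕ) : Measurable (rStar μ p q f0 f1 d) := by
  rw [show rStar μ p q f0 f1 d = _ from funext (rStar_eq_iSup hf0 hf1 hac hp d)]
  exact Measurable.iSup fun k => measurable_threshold hf0 hf1 d k

/-- The Bellman equation: monotone convergence passes to the limit in the recursion, with no
finiteness needed. -/
lemma rStar_eq_lintegral [SFinite μ] (hp : 0 < p) (d : ℕ) (w : Fin (d + 1) → E) :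
    rStar μ p q f0 f1 d w = p * ∫⁻ y, (f0 (w (Fin.last d)) y : ℝ≥0∞) *
      max (statistic p q f0 f1 d (Fin.snoc (α := fun _ => E) w y))
        (rStar μ p q f0 f1 d (Fin.tail (Fin.snoc (α := fun _ => E) w y))) ∂μ := by
  have hs : Measurable fun y : E => (Fin.snoc (α := fun _ => E) w y : Fin (d + 2) → E) :=
    measurable_snoc measurable_const measurable_id
  have h0 : Measurable fun y => (f0 (w (Fin.last d)) y : ℝ≥0∞) :=
    (hf0.measurable_comp measurable_const measurable_id).coe_nnreal_ennreal
  have hmono := threshold_monotone (q := q) hf0 hf1 hac hp d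
  have hlim := (tendsto_threshold (q := q) hf0 hf1 hac hp d w).comp (tendsto_add_atTop_nat 1)
  rw [← rStar_eq_iSup hf0 hf1 hac hp] at hlim
  refine tendsto_nhds_unique hlim (ENNReal.Tendsto.const_mul ?_ (Or.inr ENNReal.coe_ne_top))
  refine lintegral_tendsto_of_tendsto_of_monotone (fun k => (h0.mul
    (((measurable_statistic hf0 hf1 d).comp hs).max
      ((measurable_threshold hf0 hf1 d k).comp (measurable_tail.comp hs)))).aemeasurable)
    (ae_of_all _ fun y k l hkl => ?_) (ae_of_all _ fun y => ?_)
  · exact mul_le_mul_right (max_le_max_left _ (hmono hkl _)) _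
  · rw [rStar_eq_iSup hf0 hf1 hac hp]
    exact ENNReal.Tendsto.const_mul
      (tendsto_const_nhds.max (tendsto_threshold hf0 hf1 hac hp d _)) (Or.inr ENNReal.coe_ne_top)

/-- The thresholds are bounded by the posterior odds of a disorder that can still be detected. -/
lemma threshold_le (hp : 0 < p) (hpq : p + q = 1) (d k : ℕ) {w : Fin (d + 1) → E}
    (hw : L f0 f1 0 w ≠ 0) :
    threshold μ p q f0 f1 d k w ≤ 1 + q * ∑ m ∈ Finset.range d, ratio p f0 f1 (m + 1) w := by
  have hpq' : (p : ℝ≥0∞) + q = 1 := by exact_mod_cast hpq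
  -- The left side is the one-step integral of the affine function with `c = 1`. Since `ratio 0 = 1`
  -- and `p + q = 1`, the bound reproduces itself.
  have key : (p : ℝ≥0∞) * 1 + q * ∑ m ∈ Finset.range (d + 1), ratio p f0 f1 m w =
      1 + q * ∑ m ∈ Finset.range d, ratio p f0 f1 (m + 1) w := by
    rw [Finset.sum_range_succ', ratio_zero hw, mul_add, mul_one, mul_one, add_left_comm, hpq',
      add_comm]
  induction k generalizing w with
  | zero =>
    rw [← key, threshold_zero_eq hp]
    gcongr
    exact tsub_le_self
  | succ k ih =>
    rw [← key, ← lintegral_affine_ratio hf0 hf1 hac hp, threshold]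
    refine mul_le_mul_right (lintegral_mono fun y => ?_) _
    by_cases hy : f0 (w (Fin.last d)) y = 0
    · simp [hy]
    have hs : L f0 f1 0 (Fin.snoc (α := fun _ => E) w y) ≠ 0 := by
      rw [L_zero_snoc]
      exact mul_ne_zero hw hy
    refine mul_le_mul_right (max_le ?_ ?_) _
    · rw [statistic_eq]
      gcongr
      exact tsub_le_self
    -- The bound uses ratios only up to index `d`, exactly those unchanged when the oldest state is
    -- dropped. The first goal is `key` for the shifted window.
    · refine (ih (L_tail_ne_zero hs) ?_).trans ?_
      · rw [Finset.sum_range_succ', ratio_zero (L_tail_ne_zero hs), mul_add, mul_one, mul_one,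
          add_left_comm, hpq', add_comm]
      · rw [Finset.sum_range_succ]
        gcongr 1 + (q : ℝ≥0∞) * ?_
        refine (Finset.sum_le_sum fun m hm => ?_).trans le_self_add
        exact (ratio_tail (Nat.succ_le_of_lt (Finset.mem_range.1 hm)) hs).le

lemma rStar_le (hp : 0 < p) (hpq : p + q = 1) (d : ℕ) {w : Fin (d + 1) → E}
    (hw : L f0 f1 0 w ≠ 0) :
    rStar μ p q f0 f1 d w ≤ 1 + q * ∑ m ∈ Finset.range d, ratio p f0 f1 (m + 1) w := by
  rw [rStar_eq_iSup hf0 hf1 hac hp]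
  exact iSup_le fun k => threshold_le hf0 hf1 hac hp hpq d k hw

lemma rStar_lt_top (hp : 0 < p) (hpq : p + q = 1) (d : ℕ) {w : Fin (d + 1) → E}
    (hw : L f0 f1 0 w ≠ 0) : rStar μ p q f0 f1 d w < ∞ := by
  refine (rStar_le hf0 hf1 hac hp hpq d hw).trans_lt (ENNReal.add_lt_top.2
    ⟨ENNReal.one_lt_top, ENNReal.mul_lt_top ENNReal.coe_lt_top (ENNReal.sum_lt_top.2 fun m _ => ?_)⟩)
  exact (ratio_ne_top hp _ hw).lt_top

end Deterministic

/-! ### Law of the observed history relative to the survival event. -/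

section Observation

variable {E Ω : Type*} [MeasurableSpace E] [MeasurableSpace Ω] {P : Measure Ω} {μ : Measure E}
  {p q : ℝ≥0} {f0 f1 : E → E → ℝ≥0} {x : E} {θ : Ω → ℕ} {X : ℕ → Ω → E}

/-- The observed history `X 0, …, X n`. -/
def history (X : ℕ → Ω → E) (n : ℕ) (ω : Ω) : Fin (n + 1) → E := fun i => X i ω

lemma measurable_history (hX : ∀ n, Measurable (X n)) (n : ℕ) : Measurable (history X n) :=
  measurable_pi_lambda _ fun i => hX i

omit [MeasurableSpace E] [MeasurableSpace Ω] in
lemma history_succ (n : ℕ) (ω : Ω) :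
    history X (n + 1) ω = Fin.snoc (α := fun _ => E) (history X n ω) (X (n + 1) ω) := by
  refine funext fun i => Fin.lastCases ?_ (fun i => ?_) i
  · simp [history]
  · simp [history]

lemma setLIntegral_lt_eq_tsum (hθ : Measurable θ) (n : ℕ) (φ : Ω → ℝ≥0∞) :
    ∫⁻ ω in {ω | n < θ ω}, φ ω ∂P = ∑' k, ∫⁻ ω in {ω | θ ω = n + 1 + k}, φ ω ∂P := by
  have hm : ∀ k, MeasurableSet {ω | θ ω = n + 1 + k} := fun k => hθ (measurableSet_singleton _)
  rw [← lintegral_iUnion hm]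
  · congr 2
    ext ω
    simp only [Set.mem_ofPred_eq, Set.mem_iUnion]
    exact ⟨fun h => ⟨θ ω - (n + 1), by omega⟩, fun ⟨k, hk⟩ => by omega⟩
  · intro i j hij
    refine Set.disjoint_left.2 fun ω hi hj => hij ?_
    simp only [Set.mem_ofPred_eq] at hi hj
    omega

lemma measurable_lintegral_snoc [SFinite μ] {f : E → E → ℝ≥0} (hf : IsTransitionDensity μ f)
    {n : ℕ} {g : (Fin (n + 2) → E) → ℝ≥0∞} (hg : Measurable g) :
    Measurable fun h : Fin (n + 1) → E =>
      ∫⁻ y, (f (h (Fin.last n)) y : ℝ≥0∞) * g (Fin.snoc (α := fun _ => E) h y) ∂μ := by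
  refine Measurable.lintegral_prod_right' (f := fun t : (Fin (n + 1) → E) × E =>
      (f (t.1 (Fin.last n)) t.2 : ℝ≥0∞) * g (Fin.snoc (α := fun _ => E) t.1 t.2)) ?_
  exact (hf.measurable_comp ((measurable_pi_apply _).comp measurable_fst)
      measurable_snd).coe_nnreal_ennreal.mul
      (hg.comp (measurable_snoc measurable_fst measurable_snd))

lemma lintegral_pi_snoc [SigmaFinite μ] (n : ℕ) {F : (Fin (n + 1) → E) → ℝ≥0∞}
    (hF : Measurable F) :
    ∫⁻ v, F v ∂(Measure.pi fun _ : Fin (n + 1) => μ) =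
      ∫⁻ w, ∫⁻ y, F (Fin.snoc (α := fun _ => E) w y) ∂μ ∂(Measure.pi fun _ : Fin n => μ) := by
  have h := (measurePreserving_piFinSuccAbove (fun _ : Fin (n + 1) => μ) (Fin.last n)).symm
  rw [← h.lintegral_comp hF]
  refine (lintegral_prod_symm _ (hF.comp (MeasurableEquiv.measurable _)).aemeasurable).trans ?_
  simp [MeasurableEquiv.piFinSuccAbove, Fin.snocEquiv]

variable (hf0 : IsTransitionDensity μ f0) (hf1 : IsTransitionDensity μ f1)
  (hX : ∀ n, Measurable (X n)) (hmodel : IsSwitchedProcess P μ p q f0 f1 x θ X)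

include hf0 hf1 hX hmodel

section

variable [IsProbabilityMeasure P] [SigmaFinite μ]

/-- The model prescribes the next state only on rectangles. These determine the joint law of history
and next state on `{θ = j}` as a composition product, hence the integral of any `g`. -/
lemma lintegral_history_succ_of_eq (n j : ℕ) {g : (Fin (n + 2) → E) → ℝ≥0∞} (hg : Measurable g) :
    ∫⁻ ω in {ω | θ ω = j}, g (history X (n + 1) ω) ∂P =
      ∫⁻ ω in {ω | θ ω = j}, (∫⁻ y, ((if n + 1 < j then f0 else f1) (X n ω) y : ℝ≥0∞) *
        g (Fin.snoc (α := fun _ => E) (history X n ω) y) ∂μ) ∂P := by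
  set f := if n + 1 < j then f0 else f1 with hf_def
  have hf : IsTransitionDensity μ f := by
    rw [hf_def]
    split_ifs <;> assumption
  let dens : (Fin (n + 1) → E) → E → ℝ≥0 := fun h y => f (h (Fin.last n)) y
  have hdens : Measurable (Function.uncurry fun h y => (dens h y : ℝ≥0∞)) :=
    (hf.measurable_comp ((measurable_pi_apply _).comp measurable_fst)
      measurable_snd).coe_nnreal_ennreal
  let κ : ProbabilityTheory.Kernel (Fin (n + 1) → E) E :=
    ProbabilityTheory.Kernel.withDensity (ProbabilityTheory.Kernel.const _ μ)
      fun h y => (dens h y : ℝ≥0∞)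
  have : ProbabilityTheory.IsSFiniteKernel κ :=
    ProbabilityTheory.Kernel.IsSFiniteKernel.withDensity _ fun _ _ => ENNReal.coe_ne_top
  have hH := measurable_history hX n
  have hpair : Measurable fun ω => (history X n ω, X (n + 1) ω) := hH.prodMk (hX (n + 1))
  have hθj : MeasurableSet {ω | θ ω = j} := hmodel.measurable_time (measurableSet_singleton j)
  have key : (P.restrict {ω | θ ω = j}).map (fun ω => (history X n ω, X (n + 1) ω)) =
      ((P.restrict {ω | θ ω = j}).map (history X n)).compProd κ := by
    refine Measure.ext_prod fun {B A} hB hA => ?_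
    have hκ : ∀ h, κ h A = ∫⁻ y in A, (dens h y : ℝ≥0∞) ∂μ := fun h => by
      rw [ProbabilityTheory.Kernel.withDensity_apply' _ hdens,
        ProbabilityTheory.Kernel.const_apply]
    rw [Measure.map_apply hpair (hB.prod hA), Measure.restrict_apply (hpair (hB.prod hA)),
      Measure.compProd_apply_prod hB hA,
      setLIntegral_map hB (ProbabilityTheory.Kernel.measurable_coe κ hA) hH,
      Measure.restrict_restrict (hH hB)]
    convert hmodel.transition n j B A hB hA using 2
    · ext ω
      exact and_comm
    · congr 1
      ext ω
      exact and_comm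
    · funext ω
      rw [hκ]
      refine lintegral_congr fun y => ?_
      simp only [dens, hf_def, history, Fin.val_last]
      split_ifs <;> rfl
  have hgs : Measurable fun t : (Fin (n + 1) → E) × E =>
      g (Fin.snoc (α := fun _ => E) t.1 t.2) :=
    hg.comp (measurable_snoc measurable_fst measurable_snd)
  calc _ = ∫⁻ ω in {ω | θ ω = j}, g (Fin.snoc (α := fun _ => E) (history X n ω) (X (n + 1) ω)) ∂P :=
        lintegral_congr fun ω => by rw [history_succ]
    _ = ∫⁻ t, g (Fin.snoc (α := fun _ => E) t.1 t.2)
          ∂((P.restrict {ω | θ ω = j}).map (fun ω => (history X n ω, X (n + 1) ω))) :=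
        (lintegral_map hgs hpair).symm
    _ = ∫⁻ h, ∫⁻ y, (dens h y : ℝ≥0∞) * g (Fin.snoc (α := fun _ => E) h y) ∂μ
          ∂((P.restrict {ω | θ ω = j}).map (history X n)) := by
        rw [key, Measure.lintegral_compProd hgs]
        refine lintegral_congr fun h => ?_
        exact (ProbabilityTheory.Kernel.lintegral_withDensity _ hdens _
          (hgs.comp measurable_prodMk_left)).trans rfl
    _ = _ := lintegral_map (measurable_lintegral_snoc hf hg) hH

/-- Up to time `n` only `f0` transitions have occurred under either value of `θ`, so the two laws
differ by the ratio `p` of geometric weights. -/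
lemma lintegral_history_time_succ {n j : ℕ} (hnj : n < j) {g : (Fin (n + 1) → E) → ℝ≥0∞}
    (hg : Measurable g) :
    ∫⁻ ω in {ω | θ ω = j + 1}, g (history X n ω) ∂P =
      p * ∫⁻ ω in {ω | θ ω = j}, g (history X n ω) ∂P := by
  induction n with
  | zero =>
    have h0 : ∀ j, ∫⁻ ω in {ω | θ ω = j}, g (history X 0 ω) ∂P =
        g (fun _ => x) * P {ω | θ ω = j} := fun j => by
      rw [← setLIntegral_const]
      refine lintegral_congr_ae (ae_restrict_of_ae ?_)
      filter_upwards [hmodel.start] with ω hω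
      congr 1
      funext i
      rw [history, show ((i : Fin 1) : ℕ) = 0 by omega, hω]
    obtain ⟨k, rfl⟩ : ∃ k, j = k + 1 := ⟨j - 1, by omega⟩
    rw [h0, h0, hmodel.geometric _ (by omega), hmodel.geometric _ (by omega), Nat.add_sub_cancel,
      Nat.add_sub_cancel, pow_succ]
    push_cast
    ring
  | succ n ih =>
    rw [lintegral_history_succ_of_eq hf0 hf1 hX hmodel n j hg,
      lintegral_history_succ_of_eq hf0 hf1 hX hmodel n (j + 1) hg, if_pos hnj,
      if_pos (by omega : n + 1 < j + 1)]
    exact ih (by omega) (measurable_lintegral_snoc hf0 hg)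

lemma lintegral_history_time_add (n k : ℕ) {g : (Fin (n + 1) → E) → ℝ≥0∞} (hg : Measurable g) :
    ∫⁻ ω in {ω | θ ω = n + 1 + k}, g (history X n ω) ∂P =
      (p : ℝ≥0∞) ^ k * ∫⁻ ω in {ω | θ ω = n + 1}, g (history X n ω) ∂P := by
  induction k with
  | zero => simp
  | succ k ih =>
    rw [← add_assoc, lintegral_history_time_succ hf0 hf1 hX hmodel (by omega) hg, ih, pow_succ',
      mul_assoc]

/-- Memorylessness: summing the geometric series over `θ = n + 1 + k` gives a factor `1 / (1 - p) =
1 / q`. -/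
lemma lintegral_history_eq_succ (hq : 0 < q) (hpq : p + q = 1) (n : ℕ)
    {g : (Fin (n + 1) → E) → ℝ≥0∞} (hg : Measurable g) :
    ∫⁻ ω in {ω | θ ω = n + 1}, g (history X n ω) ∂P =
      q * ∫⁻ ω in {ω | n < θ ω}, g (history X n ω) ∂P := by
  have hpq' : (1 : ℝ≥0∞) - p = q := by
    have h : (p : ℝ≥0∞) + q = 1 := by exact_mod_cast hpq
    rw [← h, ENNReal.add_sub_cancel_left ENNReal.coe_ne_top]
  rw [setLIntegral_lt_eq_tsum hmodel.measurable_time]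
  simp_rw [lintegral_history_time_add hf0 hf1 hX hmodel n _ hg]
  rw [ENNReal.tsum_mul_right, ENNReal.tsum_geometric, hpq', ← mul_assoc,
    ENNReal.mul_inv_cancel (by simpa using hq.ne') ENNReal.coe_ne_top, one_mul]

lemma lintegral_history_succ_lt (n : ℕ) {g : (Fin (n + 1) → E) → ℝ≥0∞} (hg : Measurable g) :
    ∫⁻ ω in {ω | n + 1 < θ ω}, g (history X n ω) ∂P =
      p * ∫⁻ ω in {ω | n < θ ω}, g (history X n ω) ∂P := by
  rw [setLIntegral_lt_eq_tsum hmodel.measurable_time, setLIntegral_lt_eq_tsum hmodel.measurable_time,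
    ← ENNReal.tsum_mul_left]
  refine tsum_congr fun k => ?_
  rw [← lintegral_history_time_succ hf0 hf1 hX hmodel (by omega) hg, add_right_comm _ 1 k]

lemma lintegral_history_succ (n : ℕ) {g : (Fin (n + 2) → E) → ℝ≥0∞} (hg : Measurable g) :
    ∫⁻ ω in {ω | n + 1 < θ ω}, g (history X (n + 1) ω) ∂P =
      p * ∫⁻ ω in {ω | n < θ ω}, (∫⁻ y, (f0 (X n ω) y : ℝ≥0∞) *
        g (Fin.snoc (α := fun _ => E) (history X n ω) y) ∂μ) ∂P := by
  refine Eq.trans ?_ (lintegral_history_succ_lt hf0 hf1 hX hmodel n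
    (measurable_lintegral_snoc hf0 hg))
  rw [setLIntegral_lt_eq_tsum hmodel.measurable_time, setLIntegral_lt_eq_tsum hmodel.measurable_time]
  refine tsum_congr fun k => ?_
  rw [lintegral_history_succ_of_eq hf0 hf1 hX hmodel n _ hg, if_pos (by omega)]
  rfl

/-- The case `n = 0`, `g = 1` of memorylessness reads `q = q * P {0 < θ}`. -/
lemma measure_time_pos (hq : 0 < q) (hpq : p + q = 1) : P {ω | 0 < θ ω} = 1 := by
  have h := lintegral_history_eq_succ hf0 hf1 hX hmodel hq hpq 0 (g := fun _ => 1) measurable_const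
  rw [setLIntegral_one, setLIntegral_one, hmodel.geometric _ (by omega)] at h
  simp only [zero_add, Nat.sub_self, pow_zero, one_mul] at h
  have hq' : (q : ℝ≥0∞) ≠ 0 := by simpa using hq.ne'
  exact ((ENNReal.mul_right_inj hq' ENNReal.coe_ne_top).1 (by rw [mul_one, ← h])).symm

/-- On `{n < θ}` the history has density `p ^ n L_0` with respect to `μ ^ n`. -/
lemma lintegral_history_lt (hq : 0 < q) (hpq : p + q = 1) (n : ℕ)
    {g : (Fin (n + 1) → E) → ℝ≥0∞} (hg : Measurable g) :
    ∫⁻ ω in {ω | n < θ ω}, g (history X n ω) ∂P =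
      (p : ℝ≥0∞) ^ n * ∫⁻ y : Fin n → E, g (Fin.cons (α := fun _ => E) x y) *
        (L f0 f1 0 (Fin.cons (α := fun _ => E) x y) : ℝ≥0∞) ∂(Measure.pi fun _ => μ) := by
  have hcons : ∀ n, Measurable fun y : Fin n → E => (Fin.cons (α := fun _ => E) x y : Fin (n + 1) → E) :=
    fun n => measurable_pi_lambda _ fun i => by
      refine Fin.cases ?_ (fun i => ?_) i
      · simp
      · simpa using measurable_pi_apply i
  induction n with
  | zero =>
    have : ∫⁻ ω in {ω | 0 < θ ω}, g (history X 0 ω) ∂P = g (fun _ => x) := by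
      rw [← mul_one (g fun _ => x), ← measure_time_pos hf0 hf1 hX hmodel hq hpq,
        ← setLIntegral_const]
      refine lintegral_congr_ae (ae_restrict_of_ae ?_)
      filter_upwards [hmodel.start] with ω hω
      congr 1
      funext i
      rw [history, show ((i : Fin 1) : ℕ) = 0 by omega, hω]
    rw [this, Measure.pi_of_empty, lintegral_dirac' _ (by
      exact (hg.comp (hcons 0)).mul ((measurable_L hf0 hf1 0).comp (hcons 0)).coe_nnreal_ennreal)]
    have hx : (Fin.cons (α := fun _ => E) x (fun a : Fin 0 => isEmptyElim a) : Fin 1 → E) =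
        fun _ => x := by
      funext i
      rw [Subsingleton.elim (α := Fin 1) i 0]
      rfl
    simp [hx, L]
  | succ n ih =>
    have hF : Measurable fun v : Fin (n + 1) → E => g (Fin.cons (α := fun _ => E) x v) *
        (L f0 f1 0 (Fin.cons (α := fun _ => E) x v) : ℝ≥0∞) :=
      (hg.comp (hcons _)).mul ((measurable_L hf0 hf1 0).comp (hcons _)).coe_nnreal_ennreal
    rw [lintegral_history_succ hf0 hf1 hX hmodel n hg, lintegral_pi_snoc n hF, pow_succ', mul_assoc]
    congr 1
    refine (ih (measurable_lintegral_snoc hf0 hg)).trans ?_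
    congr 1
    refine lintegral_congr fun w => ?_
    rw [mul_comm, ← lintegral_const_mul _ (by
      exact (hf0.measurable_comp measurable_const measurable_id).coe_nnreal_ennreal.mul
        (hg.comp (measurable_snoc measurable_const measurable_id)))]
    refine lintegral_congr fun y => ?_
    rw [Fin.cons_snoc_eq_snoc_cons, L_zero_snoc, ENNReal.coe_mul]
    ring

/-- `L_0` is, up to a constant, the density of the history, so its zero set is null. This keeps the
degenerate values of `ratio` out of every integral. -/
lemma ae_L_history_ne_zero (hq : 0 < q) (hpq : p + q = 1) (n : ℕ) :
    ∀ᵐ ω ∂P.restrict {ω | n < θ ω}, L f0 f1 0 (history X n ω) ≠ 0 := by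
  have hS : MeasurableSet {h : Fin (n + 1) → E | L f0 f1 0 h = 0} :=
    measurable_L hf0 hf1 0 (measurableSet_singleton 0)
  have h := lintegral_history_lt hf0 hf1 hX hmodel hq hpq n
    (g := Set.indicator {h | L f0 f1 0 h = 0} 1) (measurable_one.indicator hS)
  have h0 : ∀ h : Fin (n + 1) → E,
      Set.indicator {h : Fin (n + 1) → E | L f0 f1 0 h = 0} 1 h * (L f0 f1 0 h : ℝ≥0∞) = 0 := by
    intro h
    by_cases hh : L f0 f1 0 h = 0
    · simp [hh]
    · simp [Set.indicator, hh]
  simp only [h0, lintegral_zero, mul_zero] at h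
  replace h := (lintegral_eq_zero_iff
    ((measurable_one.indicator hS).comp (measurable_history hX n))).1 h
  filter_upwards [h] with ω hω hL
  simp [Set.indicator, hL] at hω

/-- The change of measure. For `m = 0` it is memorylessness. Each later step uses `f1` on `{θ = n +
1}` and `p * f0` on survival, and the new factor of the ratio converts one into the other. -/
lemma lintegral_history_mul_ratio (hac : ∀ y, ∀ᵐ z ∂μ, f0 y z = 0 → f1 y z = 0)
    (hp : 0 < p) (hq : 0 < q) (hpq : p + q = 1) (n m : ℕ)
    {g : (Fin (n + m + 1) → E) → ℝ≥0∞} (hg : Measurable g) :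
    q * ∫⁻ ω in {ω | n + m < θ ω},
        g (history X (n + m) ω) * ratio p f0 f1 m (history X (n + m) ω) ∂P =
      ∫⁻ ω in {ω | θ ω = n + 1}, g (history X (n + m) ω) ∂P := by
  induction m with
  | zero =>
    refine Eq.trans ?_ (lintegral_history_eq_succ hf0 hf1 hX hmodel hq hpq n hg).symm
    congr 1
    refine lintegral_congr_ae ?_
    filter_upwards [ae_L_history_ne_zero hf0 hf1 hX hmodel hq hpq n] with ω hω
    exact (congrArg _ (ratio_zero hω)).trans (mul_one _)
  | succ m ih =>
    have hgr : Measurable fun h : Fin (n + m + 2) → E => g h * ratio p f0 f1 (m + 1) h :=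
      hg.mul (measurable_ratio hf0 hf1 _)
    refine (congrArg _ (lintegral_history_succ hf0 hf1 hX hmodel (n + m) hgr)).trans ?_
    refine Eq.trans ?_ (lintegral_history_succ_of_eq hf0 hf1 hX hmodel (n + m) (n + 1) hg).symm
    rw [if_neg (by omega)]
    refine Eq.trans ?_ (ih (measurable_lintegral_snoc hf1 hg))
    rw [← lintegral_const_mul' _ _ ENNReal.coe_ne_top]
    congr 1
    refine lintegral_congr fun ω => ?_
    rw [mul_comm (∫⁻ _, _ ∂μ)]
    exact lintegral_ratio_succ_snoc hf0 hf1 hac hp m (history X (n + m) ω)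
      (hg.comp (measurable_snoc measurable_const measurable_id))

end

end Observation

/-! ### Passing from the full history to its last states. -/

section Window

variable {E : Type*}

/-- The last `N + 1` states of a history of `n + 1` states. -/
def lastStates (N : ℕ) {n : ℕ} (h : Fin (n + 1) → E) : Fin (N + 1) → E :=
  fun i => h (Fin.ofNat (n + 1) (n - N + i))

lemma measurable_lastStates [MeasurableSpace E] (N n : ℕ) :
    Measurable (lastStates N : (Fin (n + 1) → E) → Fin (N + 1) → E) :=
  measurable_pi_lambda _ fun _ => measurable_pi_apply _

/-- For `N ≤ n` the index is below `n + 1`, so the reduction modulo `n + 1` in `Fin.ofNat` has no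
effect. -/
lemma lastStates_history {Ω : Type*} {X : ℕ → Ω → E} {N n : ℕ} (h : N ≤ n) (ω : Ω) :
    lastStates N (history X n ω) = fun i : Fin (N + 1) => X (n - N + i) ω := by
  funext i
  simp only [lastStates, history, Fin.val_ofNat]
  rw [Nat.mod_eq_of_lt (by omega)]

lemma lastStates_self {n : ℕ} (h : Fin (n + 1) → E) : lastStates n h = h := by
  funext i
  simp only [lastStates]
  congr 1
  ext
  simp only [Fin.val_ofNat]
  rw [Nat.mod_eq_of_lt (by omega)]
  omega

lemma tail_lastStates {N n : ℕ} (hN : N + 1 ≤ n) (h : Fin (n + 1) → E) :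
    Fin.tail (lastStates (N + 1) h) = lastStates N h := by
  funext i
  simp only [lastStates, Fin.tail]
  congr 1
  ext
  simp only [Fin.val_ofNat, Fin.val_succ]
  congr 1
  omega

lemma lastStates_snoc {N n : ℕ} (hN : N ≤ n) (h : Fin (n + 1) → E) (y : E) :
    lastStates (N + 1) (Fin.snoc (α := fun _ => E) h y : Fin (n + 2) → E) =
      Fin.snoc (α := fun _ => E) (lastStates N h) y := by
  funext i
  refine Fin.lastCases ?_ (fun i => ?_) i
  · rw [Fin.snoc_last]
    have : Fin.ofNat (n + 1 + 1) (n + 1 - (N + 1) + (Fin.last (N + 1) : Fin (N + 2))) =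
        Fin.last (n + 1) := by
      ext
      simp only [Fin.val_ofNat, Fin.val_last]
      rw [Nat.mod_eq_of_lt (by omega)]
      omega
    rw [lastStates, this, Fin.snoc_last]
  · rw [Fin.snoc_castSucc]
    have : Fin.ofNat (n + 1 + 1) (n + 1 - (N + 1) + (i.castSucc : Fin (N + 2))) =
        (Fin.ofNat (n + 1) (n - N + i)).castSucc := by
      ext
      simp only [Fin.val_ofNat, Fin.val_castSucc]
      rw [Nat.mod_eq_of_lt (by omega), Nat.mod_eq_of_lt (by omega)]
      omega
    rw [lastStates, this, Fin.snoc_castSucc, lastStates]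

lemma lastStates_last (N : ℕ) {n : ℕ} (hN : N ≤ n) (h : Fin (n + 1) → E) :
    lastStates N h (Fin.last N) = h (Fin.last n) := by
  rw [lastStates]
  congr 1
  ext
  simp only [Fin.val_ofNat, Fin.val_last]
  rw [Nat.mod_eq_of_lt (by omega)]
  omega

lemma L_lastStates_ne_zero {f0 f1 : E → E → ℝ≥0} {N n : ℕ} (hN : N ≤ n) {h : Fin (n + 1) → E}
    (hL : L f0 f1 0 h ≠ 0) : L f0 f1 0 (lastStates N h) ≠ 0 := by
  induction hN using Nat.decreasingInduction with
  | self => rwa [lastStates_self]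
  | of_succ k hk ih =>
    rw [← tail_lastStates hk]
    exact L_tail_ne_zero ih

lemma ratio_lastStates {p : ℝ≥0} {f0 f1 : E → E → ℝ≥0} {m N n : ℕ} (hm : m ≤ N) (hN : N ≤ n)
    {h : Fin (n + 1) → E} (hL : L f0 f1 0 h ≠ 0) :
    ratio p f0 f1 m (lastStates N h) = ratio p f0 f1 m h := by
  induction hN using Nat.decreasingInduction with
  | self => rw [lastStates_self]
  | of_succ k hk ih =>
    rw [← tail_lastStates hk, ratio_tail hm (L_lastStates_ne_zero hk hL), ih (hm.trans k.le_succ)]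

end Window

/-! ### Stopping payoff, continuation value and its bound. -/

section Payoff

variable {E Ω : Type*} [MeasurableSpace E] [MeasurableSpace Ω] {P : Measure Ω} {μ : Measure E}
  {p q : ℝ≥0} {f0 f1 : E → E → ℝ≥0} {x : E} {θ : Ω → ℕ} {X : ℕ → Ω → E}
  [IsProbabilityMeasure P] [SigmaFinite μ]
  (hf0 : IsTransitionDensity μ f0) (hf1 : IsTransitionDensity μ f1)
  (hac : ∀ y, ∀ᵐ z ∂μ, f0 y z = 0 → f1 y z = 0)
  (hX : ∀ n, Measurable (X n)) (hmodel : IsSwitchedProcess P μ p q f0 f1 x θ X)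
  (hp : 0 < p) (hq : 0 < q) (hpq : p + q = 1)

include hf0 hf1 hac hX hmodel hp hq hpq

lemma lintegral_history_mul_ratio_lastStates {n m N : ℕ} (hmN : m + 1 ≤ N) (hN : N ≤ n)
    {g : (Fin (n + 1) → E) → ℝ≥0∞} (hg : Measurable g) :
    q * ∫⁻ ω in {ω | n < θ ω},
        g (history X n ω) * ratio p f0 f1 (m + 1) (lastStates N (history X n ω)) ∂P =
      ∫⁻ ω in {ω | θ ω = n - m}, g (history X n ω) ∂P := by
  have h1 : ∫⁻ ω in {ω | n < θ ω},
        g (history X n ω) * ratio p f0 f1 (m + 1) (lastStates N (history X n ω)) ∂P =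
      ∫⁻ ω in {ω | n < θ ω}, g (history X n ω) * ratio p f0 f1 (m + 1) (history X n ω) ∂P := by
    refine lintegral_congr_ae ?_
    filter_upwards [ae_L_history_ne_zero hf0 hf1 hX hmodel hq hpq n] with ω hω
    rw [ratio_lastStates hmN hN hω]
  obtain ⟨k, rfl⟩ : ∃ k, n = k + (m + 1) := ⟨n - (m + 1), by omega⟩
  rw [h1, lintegral_history_mul_ratio hf0 hf1 hX hmodel hac hp hq hpq k (m + 1) hg,
    show k + (m + 1) - m = k + 1 by omega]

/-- Each ratio contributes one past disorder time. `D = d + 1` serves the payoff at time `n`; `D =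
d` serves the bound on `r*`, where stopping is still at least one step away. -/
lemma lintegral_history_mul_sum_ratio {n N D : ℕ} (hD : D ≤ N) (hN : N ≤ n)
    {g : (Fin (n + 1) → E) → ℝ≥0∞} (hg : Measurable g) :
    ∫⁻ ω in {ω | n < θ ω}, g (history X n ω) *
        (q * ∑ m ∈ Finset.range D, ratio p f0 f1 (m + 1) (lastStates N (history X n ω))) ∂P =
      ∫⁻ ω in {ω | n < θ ω + D ∧ θ ω ≤ n}, g (history X n ω) ∂P := by
  have hr : ∀ m, Measurable fun ω =>
      g (history X n ω) * ratio p f0 f1 (m + 1) (lastStates N (history X n ω)) := fun m =>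
    (hg.comp (measurable_history hX n)).mul (((measurable_ratio hf0 hf1 _).comp
      (measurable_lastStates N n)).comp (measurable_history hX n))
  have hset : {ω | n < θ ω + D ∧ θ ω ≤ n} = ⋃ m ∈ Finset.range D, {ω | θ ω = n - m} := by
    ext ω
    simp only [Set.mem_ofPred_eq, Set.mem_iUnion, Finset.mem_range, exists_prop]
    exact ⟨fun h => ⟨n - θ ω, by omega, by omega⟩, fun ⟨m, hm, h⟩ => by omega⟩
  have hmeas : ∀ m, MeasurableSet {ω | θ ω = n - m} := fun m =>
    hmodel.measurable_time (measurableSet_singleton _)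
  rw [hset, lintegral_biUnion_finset (fun i hi j hj hij => Set.disjoint_left.2 fun ω h1 h2 => by
    have hi' := Finset.mem_range.1 hi
    have hj' := Finset.mem_range.1 hj
    simp only [Set.mem_ofPred_eq] at h1 h2
    omega) fun m _ => hmeas m]
  simp_rw [mul_left_comm _ (q : ℝ≥0∞), Finset.mul_sum]
  rw [lintegral_finsetSum _ fun m _ => (hr m).const_mul _]
  refine Finset.sum_congr rfl fun m hm => ?_
  rw [lintegral_const_mul _ (hr m)]
  have := Finset.mem_range.1 hm
  exact lintegral_history_mul_ratio_lastStates hf0 hf1 hac hX hmodel hp hq hpq (by omega) hN hg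

omit hac hp in
lemma lintegral_history_soon (n d : ℕ) {g : (Fin (n + 1) → E) → ℝ≥0∞} (hg : Measurable g) :
    ∫⁻ ω in {ω | n < θ ω ∧ θ ω ≤ n + d}, g (history X n ω) ∂P =
      (1 - (p : ℝ≥0∞) ^ d) * ∫⁻ ω in {ω | n < θ ω}, g (history X n ω) ∂P := by
  have hset : {ω | n < θ ω ∧ θ ω ≤ n + d} = ⋃ k ∈ Finset.range d, {ω | θ ω = n + 1 + k} := by
    ext ω
    simp only [Set.mem_ofPred_eq, Set.mem_iUnion, Finset.mem_range, exists_prop]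
    exact ⟨fun h => ⟨θ ω - (n + 1), by omega, by omega⟩, fun ⟨m, hm, h⟩ => by omega⟩
  have hmeas : ∀ k, MeasurableSet {ω | θ ω = n + 1 + k} := fun k =>
    hmodel.measurable_time (measurableSet_singleton _)
  have hgeom : ∀ d : ℕ, (∑ k ∈ Finset.range d, (p : ℝ≥0∞) ^ k) * q + (p : ℝ≥0∞) ^ d = 1 := by
    have hpq' : (p : ℝ≥0∞) + q = 1 := by exact_mod_cast hpq
    intro d
    induction d with
    | zero => simp
    | succ d ih =>
      rw [Finset.sum_range_succ, add_mul, pow_succ, add_assoc, ← mul_add, add_comm (q : ℝ≥0∞), hpq',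
        mul_one, ih]
  rw [hset, lintegral_biUnion_finset (fun i _ j _ hij => Set.disjoint_left.2 fun ω h1 h2 => by
    simp only [Set.mem_ofPred_eq] at h1 h2
    omega) fun m _ => hmeas m]
  simp_rw [lintegral_history_time_add hf0 hf1 hX hmodel n _ hg]
  rw [← Finset.sum_mul, lintegral_history_eq_succ hf0 hf1 hX hmodel hq hpq n hg, ← mul_assoc,
    ← hgeom d, ENNReal.add_sub_cancel_right (ENNReal.pow_ne_top ENNReal.coe_ne_top)]

/-- The statistic is, up to the posterior probability of `{n < θ}`, the conditional probability
of detection when stopping at time `n`. -/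
lemma lintegral_history_mul_statistic {n d : ℕ} (hn : d + 1 ≤ n)
    {g : (Fin (n + 1) → E) → ℝ≥0∞} (hg : Measurable g) :
    ∫⁻ ω in {ω | n < θ ω},
        g (history X n ω) * statistic p q f0 f1 d (lastStates (d + 1) (history X n ω)) ∂P =
      ∫⁻ ω in {ω | |(θ ω : ℤ) - n| ≤ d}, g (history X n ω) ∂P := by
  have hset : {ω | |(θ ω : ℤ) - n| ≤ d} =
      {ω | n < θ ω ∧ θ ω ≤ n + d} ∪ {ω | n < θ ω + (d + 1) ∧ θ ω ≤ n} := by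
    ext ω
    simp only [Set.mem_ofPred_eq, Set.mem_union, abs_le]
    omega
  have hgm : Measurable fun ω => g (history X n ω) := hg.comp (measurable_history hX n)
  have hm : MeasurableSet {ω | n < θ ω + (d + 1) ∧ θ ω ≤ n} :=
    hmodel.measurable_time (MeasurableSet.of_discrete (s := {k | n < k + (d + 1) ∧ k ≤ n}))
  rw [hset, lintegral_union hm (Set.disjoint_left.2 fun ω h1 h2 => by
    simp only [Set.mem_ofPred_eq] at h1 h2
    omega), lintegral_history_soon hf0 hf1 hX hmodel hq hpq n d hg,
    ← lintegral_history_mul_sum_ratio hf0 hf1 hac hX hmodel hp hq hpq le_rfl hn hg]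
  simp_rw [statistic_eq, mul_add]
  rw [lintegral_add_left (hgm.mul_const _), lintegral_mul_const _ hgm, mul_comm]

/-- The value of stopping optimally at or after the current time, relative to `{n < θ}`. -/
noncomputable def value (μ : Measure E) (p q : ℝ≥0) (f0 f1 : E → E → ℝ≥0) (d : ℕ) {n : ℕ}
    (h : Fin (n + 1) → E) : ℝ≥0∞ :=
  max (statistic p q f0 f1 d (lastStates (d + 1) h)) (rStar μ p q f0 f1 d (lastStates d h))

omit hX hmodel hq hpq in
omit [IsProbabilityMeasure P] [MeasurableSpace Ω] in
lemma measurable_value (d n : ℕ) :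
    Measurable (value μ p q f0 f1 d : (Fin (n + 1) → E) → ℝ≥0∞) :=
  ((measurable_statistic hf0 hf1 d).comp (measurable_lastStates _ _)).max
    ((measurable_rStar hf0 hf1 hac hp d).comp (measurable_lastStates _ _))

-- The Bellman equation integrated over survival. The weight `g` depends on the history up to time
-- `n` only; it will be the decision to continue.
omit hq hpq in
lemma lintegral_history_mul_value {n d : ℕ} (hn : d + 1 ≤ n) {g : (Fin (n + 1) → E) → ℝ≥0∞}
    (hg : Measurable g) :
    ∫⁻ ω in {ω | n + 1 < θ ω}, g (history X n ω) * value μ p q f0 f1 d (history X (n + 1) ω) ∂P =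
      ∫⁻ ω in {ω | n < θ ω},
        g (history X n ω) * rStar μ p q f0 f1 d (lastStates d (history X n ω)) ∂P := by
  have hV := measurable_value (q := q) (μ := μ) hf0 hf1 hac hp d (n + 1)
  have h := lintegral_history_succ hf0 hf1 hX hmodel n
    (g := fun h => g (Fin.init h) * value μ p q f0 f1 d h) ((hg.comp measurable_init).mul hV)
  have hinit : ∀ ω, Fin.init (history X (n + 1) ω) = history X n ω := fun ω => rfl
  simp only [hinit, Fin.init_snoc] at h
  rw [h, ← lintegral_const_mul' _ _ ENNReal.coe_ne_top]
  refine lintegral_congr fun ω => ?_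
  rw [rStar_eq_lintegral hf0 hf1 hac hp, mul_left_comm (g _),
    ← lintegral_const_mul (g (history X n ω))]
  · congr 1
    refine lintegral_congr fun y => ?_
    rw [value, lastStates_snoc (by omega), ← tail_lastStates (by omega) (Fin.snoc _ y),
      lastStates_snoc (by omega), lastStates_last d (by omega), mul_left_comm]
    rfl
  · have hs : Measurable fun y : E =>
        (Fin.snoc (α := fun _ => E) (lastStates d (history X n ω)) y : Fin (d + 2) → E) :=
      measurable_snoc measurable_const measurable_id
    exact (hf0.measurable_comp measurable_const measurable_id).coe_nnreal_ennreal.mul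
      (((measurable_statistic hf0 hf1 d).comp hs).max
        ((measurable_rStar hf0 hf1 hac hp d).comp (measurable_tail.comp hs)))

/-- In the pointwise bound on `r*`, the term `1` integrates to `P {n < θ}` and the ratios to the
probability of `n - d < θ ≤ n`. -/
lemma lintegral_rStar_le {n d : ℕ} (hn : d ≤ n) :
    ∫⁻ ω in {ω | n < θ ω}, rStar μ p q f0 f1 d (lastStates d (history X n ω)) ∂P ≤
      P {ω | n < θ ω + d} := by
  have hset : {ω | n < θ ω + d} = {ω | n < θ ω} ∪ {ω | n < θ ω + d ∧ θ ω ≤ n} := by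
    ext ω
    simp only [Set.mem_ofPred_eq, Set.mem_union]
    omega
  have hm : MeasurableSet {ω | n < θ ω + d ∧ θ ω ≤ n} :=
    hmodel.measurable_time (MeasurableSet.of_discrete (s := {k | n < k + d ∧ k ≤ n}))
  have hsum := lintegral_history_mul_sum_ratio hf0 hf1 hac hX hmodel hp hq hpq (le_refl d) hn
    (g := fun _ => 1) measurable_const
  simp only [one_mul, setLIntegral_one] at hsum
  rw [hset, measure_union (Set.disjoint_left.2 fun ω h1 h2 => by
    simp only [Set.mem_ofPred_eq] at h1 h2
    omega) hm, ← hsum, ← setLIntegral_one, ← lintegral_add_left measurable_const]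
  refine lintegral_mono_ae ?_
  filter_upwards [ae_L_history_ne_zero hf0 hf1 hX hmodel hq hpq n] with ω hω
  exact rStar_le hf0 hf1 hac hp hpq d (L_lastStates_ne_zero hn hω)

end Payoff

/-! ### Observable events as events of the history. -/

section StoppingTime

variable {E Ω : Type*} [MeasurableSpace E] [MeasurableSpace Ω] {X : ℕ → Ω → E}

lemma observed_le_comap_history (hX : ∀ n, Measurable (X n)) (n : ℕ) :
    (observed X hX n : MeasurableSpace Ω) ≤ MeasurableSpace.comap (history X n) inferInstance := by
  refine iSup₂_le fun j hj => ?_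
  have : X j = (fun h : Fin (n + 1) → E => h ⟨j, by omega⟩) ∘ history X n := rfl
  rw [this, ← MeasurableSpace.comap_comp]
  exact MeasurableSpace.comap_mono (measurable_pi_apply _).comap_le

lemma measurable_observed_history (hX : ∀ n, Measurable (X n)) {k n : ℕ} (hkn : k ≤ n) :
    Measurable[observed X hX n] (history X k) := by
  refine @measurable_pi_lambda _ _ _ (observed X hX n) _ _ fun i => ?_
  refine (comap_measurable (X i)).mono ?_ le_rfl
  exact le_iSup₂_of_le (f := fun j (_ : j ≤ n) => MeasurableSpace.comap (X j) inferInstance)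
    (i : ℕ) (by omega) le_rfl

lemma exists_history_preimage (hX : ∀ n, Measurable (X n)) {n : ℕ} {S : Set Ω}
    (hS : MeasurableSet[observed X hX n] S) :
    ∃ B : Set (Fin (n + 1) → E), MeasurableSet B ∧ history X n ⁻¹' B = S :=
  observed_le_comap_history hX n S hS

end StoppingTime

/-! ### Dynamic programming: upper bound and attainment. -/

section Optimality

variable {E Ω : Type*} [MeasurableSpace E] [MeasurableSpace Ω] {P : Measure Ω} {μ : Measure E}
  {p q : ℝ≥0} {f0 f1 : E → E → ℝ≥0} {x : E} {θ : Ω → ℕ} {X : ℕ → Ω → E}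
  [IsProbabilityMeasure P] [SigmaFinite μ]
  (hf0 : IsTransitionDensity μ f0) (hf1 : IsTransitionDensity μ f1)
  (hac : ∀ y, ∀ᵐ z ∂μ, f0 y z = 0 → f1 y z = 0)
  (hX : ∀ n, Measurable (X n)) (hmodel : IsSwitchedProcess P μ p q f0 f1 x θ X)
  (hp : 0 < p) (hq : 0 < q) (hpq : p + q = 1)

lemma measurableSet_near (hθ : Measurable θ) (n d : ℕ) :
    MeasurableSet {ω | |(θ ω : ℤ) - n| ≤ d} :=
  hθ (MeasurableSet.of_discrete (s := {k : ℕ | |(k : ℤ) - n| ≤ d}))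

omit [IsProbabilityMeasure P] in
/-- The detection probability of a rule that never stops before time `s`. -/
lemma measure_detection_eq_tsum (hX : ∀ n, Measurable (X n)) (hθ : Measurable θ) {τ : Ω → ℕ∞}
    (hτ : IsStoppingTime (observed X hX) τ) (d : ℕ) {s : ℕ} (hs : ∀ ω, (s : ℕ∞) ≤ τ ω) :
    P (detection d θ τ) = ∑' i : ℕ, P ({ω | |(θ ω : ℤ) - (s + i : ℕ)| ≤ d} ∩
      {ω | τ ω = ((s + i : ℕ) : ℕ∞)}) := by
  have hset : detection d θ τ = ⋃ i : ℕ, {ω | |(θ ω : ℤ) - (s + i : ℕ)| ≤ d} ∩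
      {ω | τ ω = ((s + i : ℕ) : ℕ∞)} := by
    ext ω
    simp only [detection, Set.mem_ofPred_eq, Set.mem_iUnion, Set.mem_inter_iff]
    constructor
    · rintro ⟨n, hn, h⟩
      have hsn : s ≤ n := by
        have := hs ω
        rw [hn] at this
        exact_mod_cast this
      obtain ⟨i, rfl⟩ := Nat.exists_eq_add_of_le hsn
      exact ⟨i, h, hn⟩
    · rintro ⟨i, h, hn⟩
      exact ⟨s + i, hn, h⟩
  rw [hset, measure_iUnion]
  · intro i j hij
    refine Set.disjoint_left.2 fun ω h1 h2 => hij ?_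
    have : ((s + i : ℕ) : ℕ∞) = (s + j : ℕ) := h1.2.symm.trans h2.2
    have := Nat.cast_injective this
    omega
  · exact fun i => (measurableSet_near hθ _ d).inter
      ((observed X hX).le _ _ (hτ.measurableSet_eq _))

include hf0 hf1 hac hX hmodel hp hq hpq

/-- One step of the dynamic programming recursion, for a rule observed at time `n`. -/
lemma detection_add_continuation {n d : ℕ} (hn : d + 1 ≤ n) {τ : Ω → ℕ∞}
    (hτ : IsStoppingTime (observed X hX) τ) :
    P ({ω | |(θ ω : ℤ) - n| ≤ d} ∩ {ω | τ ω = n}) +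
        ∫⁻ ω in {ω | n + 1 < θ ω}, {ω | ((n + 1 : ℕ) : ℕ∞) ≤ τ ω}.indicator
          (fun ω => value μ p q f0 f1 d (history X (n + 1) ω)) ω ∂P =
      ∫⁻ ω in {ω | n < θ ω}, {ω | τ ω = n}.indicator
          (fun ω => statistic p q f0 f1 d (lastStates (d + 1) (history X n ω))) ω +
        {ω | ((n + 1 : ℕ) : ℕ∞) ≤ τ ω}.indicator
          (fun ω => rStar μ p q f0 f1 d (lastStates d (history X n ω))) ω ∂P := by
  -- Stopping at `n` and continuing past `n` are both decided by the history up to `n`, so their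
  -- indicators can serve as the weights `g`.
  obtain ⟨B, hB, hBτ⟩ := exists_history_preimage hX (hτ.measurableSet_eq n)
  change history X n ⁻¹' B = {ω | τ ω = (n : ℕ∞)} at hBτ
  obtain ⟨C, hC, hCτ⟩ := exists_history_preimage hX (hτ.measurableSet_gt n)
  have hCτ' : history X n ⁻¹' C = {ω | ((n + 1 : ℕ) : ℕ∞) ≤ τ ω} := by
    rw [hCτ]
    ext ω
    push_cast
    exact (ENat.add_one_le_iff (ENat.natCast_ne_top n)).symm
  have hind : ∀ (D : Set (Fin (n + 1) → E)) (φ : Ω → ℝ≥0∞) (ω : Ω),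
      (history X n ⁻¹' D).indicator φ ω = D.indicator 1 (history X n ω) * φ ω := by
    intro D φ ω
    by_cases h : history X n ω ∈ D <;> simp [Set.indicator, h]
  have hpay := lintegral_history_mul_statistic hf0 hf1 hac hX hmodel hp hq hpq hn
    (g := B.indicator 1) (measurable_one.indicator hB)
  have hval := lintegral_history_mul_value hf0 hf1 hac hX hmodel hp hn
    (g := C.indicator 1) (measurable_one.indicator hC)
  rw [← hBτ, ← hCτ']
  simp_rw [hind]
  have hH := measurable_history hX n
  rw [lintegral_add_left, hpay, hval]
  · congr 1
    rw [show (fun ω => B.indicator (1 : (Fin (n + 1) → E) → ℝ≥0∞) (history X n ω)) =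
      (history X n ⁻¹' B).indicator 1 from rfl, lintegral_indicator_one (hH hB),
      Measure.restrict_apply (hH hB), Set.inter_comm]
  · exact ((measurable_one.indicator hB).comp hH).mul (((measurable_statistic hf0 hf1 d).comp
      (measurable_lastStates _ _)).comp hH)

/-- No rule that starts at time `d + 1` beats the value at time `d + 1`. -/
lemma measure_detection_le (d : ℕ) {τ : Ω → ℕ∞} (hτ : IsStoppingTime (observed X hX) τ)
    (hs : ∀ ω, ((d + 1 : ℕ) : ℕ∞) ≤ τ ω) :
    P (detection d θ τ) ≤
      ∫⁻ ω in {ω | d + 1 < θ ω}, value μ p q f0 f1 d (history X (d + 1) ω) ∂P := by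
  rw [measure_detection_eq_tsum hX hmodel.measurable_time hτ d hs, ENNReal.tsum_eq_iSup_nat]
  refine iSup_le fun M => ?_
  -- Keeping the value of the rules still running makes the partial sums nonincreasing in `M`, so
  -- the induction closes.
  suffices h : ∑ i ∈ Finset.range M, P ({ω | |(θ ω : ℤ) - (d + 1 + i : ℕ)| ≤ d} ∩
        {ω | τ ω = ((d + 1 + i : ℕ) : ℕ∞)}) +
      ∫⁻ ω in {ω | d + 1 + M < θ ω}, {ω | ((d + 1 + M : ℕ) : ℕ∞) ≤ τ ω}.indicator
          (fun ω => value μ p q f0 f1 d (history X (d + 1 + M) ω)) ω ∂P ≤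
      ∫⁻ ω in {ω | d + 1 < θ ω}, value μ p q f0 f1 d (history X (d + 1) ω) ∂P from
    le_self_add.trans h
  induction M with
  | zero =>
    rw [Finset.sum_range_zero, zero_add]
    exact lintegral_mono fun ω => Set.indicator_le_self _ _ _
  | succ M ih =>
    rw [Finset.sum_range_succ, add_assoc]
    refine (add_le_add_right ?_ _).trans ih
    refine (detection_add_continuation hf0 hf1 hac hX hmodel hp hq hpq
      (n := d + 1 + M) (by omega) hτ).trans_le (lintegral_mono fun ω => ?_)
    by_cases h1 : τ ω = ((d + 1 + M : ℕ) : ℕ∞)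
    · have h2 : ¬ ((d + 1 + M + 1 : ℕ) : ℕ∞) ≤ τ ω := by
        rw [h1]
        exact_mod_cast (Nat.lt_succ_self _).not_ge
      simp only [Set.indicator, Set.mem_ofPred_eq, if_pos h1, if_neg h2, add_zero, if_pos h1.ge]
      exact le_max_left _ _
    · by_cases h2 : ((d + 1 + M + 1 : ℕ) : ℕ∞) ≤ τ ω
      · have h3 : ((d + 1 + M : ℕ) : ℕ∞) ≤ τ ω := le_trans (by exact_mod_cast Nat.le_succ _) h2
        simp only [Set.indicator, Set.mem_ofPred_eq, if_neg h1, if_pos h2, zero_add, if_pos h3]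
        exact le_max_right _ _
      · simp only [Set.indicator, Set.mem_ofPred_eq, if_neg h1, if_neg h2, zero_add, zero_le]

omit hac hp in
/-- Waiting until time `d + 1` does not lose any detection. -/
lemma measure_detection_le_max (d : ℕ) (τ : Ω → ℕ∞) :
    P (detection d θ τ) ≤ P (detection d θ fun ω => max (τ ω) ((d + 1 : ℕ) : ℕ∞)) := by
  have hpos : ∀ᵐ ω ∂P, 0 < θ ω := by
    have hm : MeasurableSet {ω | 0 < θ ω} := hmodel.measurable_time measurableSet_Ioi
    exact (prob_compl_eq_zero_iff hm).2 (measure_time_pos hf0 hf1 hX hmodel hq hpq)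
  refine measure_mono_ae ?_
  filter_upwards [hpos] with ω hω
  rintro ⟨n, hn, h⟩
  -- If `n ≤ d`, then `1 ≤ θ ≤ n + d ≤ 2 * d`, which lies within `d` of `d + 1`.
  refine ⟨max n (d + 1), ?_, ?_⟩
  · simp only [hn]
    exact ((Nat.mono_cast (α := ℕ∞)).map_max (a := n) (b := d + 1)).symm
  · rw [abs_le] at h ⊢
    omega

/-- A rule that stops exactly when the statistic reaches the continuation value is optimal. -/
lemma measure_detection_eq (d : ℕ) {τ : Ω → ℕ∞} (hτ : IsStoppingTime (observed X hX) τ)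
    (hs : ∀ ω, ((d + 1 : ℕ) : ℕ∞) ≤ τ ω)
    (hreach : ∀ (n : ℕ) ω, τ ω = (n : ℕ∞) → rStar μ p q f0 f1 d (lastStates d (history X n ω)) ≤
      statistic p q f0 f1 d (lastStates (d + 1) (history X n ω)))
    (hcont : ∀ (n : ℕ) ω, d + 1 ≤ n → (n : ℕ∞) < τ ω →
      statistic p q f0 f1 d (lastStates (d + 1) (history X n ω)) ≤
        rStar μ p q f0 f1 d (lastStates d (history X n ω))) :
    P (detection d θ τ) =
      ∫⁻ ω in {ω | d + 1 < θ ω}, value μ p q f0 f1 d (history X (d + 1) ω) ∂P := by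
  set c : ℕ → ℝ≥0∞ := fun n => ∫⁻ ω in {ω | n < θ ω}, {ω | (n : ℕ∞) ≤ τ ω}.indicator
    (fun ω => value μ p q f0 f1 d (history X n ω)) ω ∂P with hc
  have hc0 : c (d + 1) =
      ∫⁻ ω in {ω | d + 1 < θ ω}, value μ p q f0 f1 d (history X (d + 1) ω) ∂P :=
    lintegral_congr fun ω => Set.indicator_of_mem (s := {ω | ((d + 1 : ℕ) : ℕ∞) ≤ τ ω}) (hs ω) _
  have hsum : ∀ M, ∑ i ∈ Finset.range M, P ({ω | |(θ ω : ℤ) - (d + 1 + i : ℕ)| ≤ d} ∩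
        {ω | τ ω = ((d + 1 + i : ℕ) : ℕ∞)}) + c (d + 1 + M) = c (d + 1) := by
    intro M
    induction M with
    | zero => simp
    | succ M ih =>
      rw [← ih, Finset.sum_range_succ, add_assoc]
      congr 1
      refine (detection_add_continuation hf0 hf1 hac hX hmodel hp hq hpq
        (n := d + 1 + M) (by omega) hτ).trans (lintegral_congr fun ω => ?_)
      by_cases h1 : τ ω = ((d + 1 + M : ℕ) : ℕ∞)
      · have h2 : ¬ ((d + 1 + M + 1 : ℕ) : ℕ∞) ≤ τ ω := by
          rw [h1]
          exact_mod_cast (Nat.lt_succ_self _).not_ge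
        simp only [Set.indicator, Set.mem_ofPred_eq, if_pos h1, if_neg h2, add_zero, if_pos h1.ge]
        exact (max_eq_left (hreach _ ω h1)).symm
      · by_cases h2 : ((d + 1 + M + 1 : ℕ) : ℕ∞) ≤ τ ω
        · have h3 : ((d + 1 + M : ℕ) : ℕ∞) < τ ω :=
            lt_of_lt_of_le (by exact_mod_cast Nat.lt_succ_self _) h2
          simp only [Set.indicator, Set.mem_ofPred_eq, if_neg h1, if_pos h2, zero_add, if_pos h3.le]
          exact (max_eq_right (hcont _ ω (by omega) h3)).symm
        · have h3 : ¬ ((d + 1 + M : ℕ) : ℕ∞) ≤ τ ω := fun h3 => by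
            have h4 := (ENat.add_one_le_iff (ENat.natCast_ne_top (d + 1 + M))).2
              (lt_of_le_of_ne h3 (Ne.symm h1))
            exact h2 (by exact_mod_cast h4)
          simp only [Set.indicator, Set.mem_ofPred_eq, if_neg h1, if_neg h2, zero_add, if_neg h3]
  -- The remainder at time `n + 1` is bounded by the integral of `r*` at time `n`, for which
  -- `lintegral_rStar_le` applies; hence the shift by one.
  have hcle : ∀ M, c (d + 1 + (M + 1)) ≤ P {ω | M < θ ω} := by
    intro M
    have hval := lintegral_history_mul_value hf0 hf1 hac hX hmodel hp
      (n := d + 1 + M) (d := d) (by omega) (g := fun _ => 1) measurable_const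
    simp only [one_mul] at hval
    calc c (d + 1 + (M + 1))
        ≤ ∫⁻ ω in {ω | d + 1 + M + 1 < θ ω}, value μ p q f0 f1 d (history X (d + 1 + M + 1) ω) ∂P :=
          lintegral_mono fun ω => Set.indicator_le_self _ _ _
      _ ≤ P {ω | d + 1 + M < θ ω + d} := by
          rw [hval]
          exact lintegral_rStar_le hf0 hf1 hac hX hmodel hp hq hpq (by omega)
      _ ≤ P {ω | M < θ ω} := measure_mono fun ω h => by
          simp only [Set.mem_ofPred_eq] at h ⊢
          omega
  have hlim : Tendsto (fun M => P {ω | M < θ ω}) atTop (𝓝 0) := by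
    have h := tendsto_measure_iInter_atTop (μ := P) (s := fun M => {ω | M < θ ω})
      (fun M => (hmodel.measurable_time measurableSet_Ioi).nullMeasurableSet)
      (fun M N hMN ω h => lt_of_le_of_lt hMN h) ⟨0, measure_ne_top _ _⟩
    have he : ⋂ M, {ω | M < θ ω} = (∅ : Set Ω) :=
      Set.eq_empty_of_forall_notMem fun ω h => lt_irrefl (θ ω) (Set.mem_iInter.1 h (θ ω))
    rwa [he, measure_empty] at h
  have hclim : Tendsto (fun M => c (d + 1 + (M + 1))) atTop (𝓝 0) :=
    tendsto_of_tendsto_of_tendsto_of_le_of_le tendsto_const_nhds hlim (fun _ => zero_le) hcle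
  rw [measure_detection_eq_tsum hX hmodel.measurable_time hτ d hs, ← hc0]
  have h1 := (ENNReal.summable.hasSum.tendsto_sum_nat (f := fun i : ℕ =>
    P ({ω | |(θ ω : ℤ) - (d + 1 + i : ℕ)| ≤ d} ∩ {ω | τ ω = ((d + 1 + i : ℕ) : ℕ∞)}))).comp
    (tendsto_add_atTop_nat 1)
  have h2 := h1.add hclim
  rw [add_zero] at h2
  refine tendsto_nhds_unique h2 (tendsto_const_nhds.congr fun M => (hsum (M + 1)).symm)

end Optimality

/-! ### The rule `τ*` as a first entrance time. -/

section TauStar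

variable {E Ω : Type*} [MeasurableSpace E] {μ : Measure E} {p q : ℝ≥0}
  {f0 f1 : E → E → ℝ≥0} {X : ℕ → Ω → E} {d : ℕ}

/-- The event that the statistic reaches the threshold at time `n`. -/
def reached (μ : Measure E) (p q : ℝ≥0) (f0 f1 : E → E → ℝ≥0) (d : ℕ) (X : ℕ → Ω → E) (n : ℕ) :
    Set Ω :=
  {ω | rStar μ p q f0 f1 d (lastStates d (history X n ω)) ≤
    statistic p q f0 f1 d (lastStates (d + 1) (history X n ω))}

lemma tauStar_eq (ω : Ω) : tauStar μ p q f0 f1 d X ω =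
    sInf {t : ℕ∞ | ∃ n : ℕ, t = n ∧ d + 1 ≤ n ∧ ω ∈ reached μ p q f0 f1 d X n} := by
  unfold tauStar
  congr 1
  ext t
  refine exists_congr fun n => and_congr_right fun _ => and_congr_right fun hn => ?_
  rw [reached, Set.mem_ofPred_eq, lastStates_history (by omega), lastStates_history hn]

lemma tauStar_le_iff (ω : Ω) (n : ℕ) : tauStar μ p q f0 f1 d X ω ≤ n ↔
    ∃ k ≤ n, d + 1 ≤ k ∧ ω ∈ reached μ p q f0 f1 d X k := by
  rw [tauStar_eq]
  constructor
  · intro h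
    rcases Set.eq_empty_or_nonempty
      {t : ℕ∞ | ∃ n : ℕ, t = n ∧ d + 1 ≤ n ∧ ω ∈ reached μ p q f0 f1 d X n} with he | hne
    · rw [he, sInf_empty] at h
      exact absurd h (by simp)
    -- `ℕ∞` is well ordered, so the infimum of a nonempty set is attained.
    · obtain ⟨k, hk, hdk, hr⟩ := csInf_mem hne
      rw [hk] at h
      exact ⟨k, Nat.cast_le.1 h, hdk, hr⟩
  · rintro ⟨k, hk, hdk, hr⟩
    have hmem : (k : ℕ∞) ∈
        {t : ℕ∞ | ∃ n : ℕ, t = n ∧ d + 1 ≤ n ∧ ω ∈ reached μ p q f0 f1 d X n} :=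
      ⟨k, rfl, hdk, hr⟩
    exact (sInf_le hmem).trans (Nat.cast_le.2 hk)

lemma le_tauStar (ω : Ω) : ((d + 1 : ℕ) : ℕ∞) ≤ tauStar μ p q f0 f1 d X ω := by
  rw [tauStar_eq]
  refine le_sInf ?_
  rintro _ ⟨n, rfl, hn, -⟩
  exact_mod_cast hn

lemma mem_reached_of_tauStar_eq {n : ℕ} {ω : Ω} (h : tauStar μ p q f0 f1 d X ω = n) :
    ω ∈ reached μ p q f0 f1 d X n := by
  obtain ⟨k, hk, hdk, hr⟩ := (tauStar_le_iff ω n).1 h.le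
  have : tauStar μ p q f0 f1 d X ω ≤ k := (tauStar_le_iff ω k).2 ⟨k, le_rfl, hdk, hr⟩
  rw [h] at this
  rwa [le_antisymm (by exact_mod_cast this) hk]

lemma notMem_reached_of_lt_tauStar {n : ℕ} {ω : Ω} (hn : d + 1 ≤ n)
    (h : (n : ℕ∞) < tauStar μ p q f0 f1 d X ω) : ω ∉ reached μ p q f0 f1 d X n :=
  fun hr => h.not_ge ((tauStar_le_iff ω n).2 ⟨n, le_rfl, hn, hr⟩)

lemma isStoppingTime_tauStar [MeasurableSpace Ω] [SFinite μ] (hf0 : IsTransitionDensity μ f0)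
    (hf1 : IsTransitionDensity μ f1) (hac : ∀ y, ∀ᵐ z ∂μ, f0 y z = 0 → f1 y z = 0) (hp : 0 < p)
    (hX : ∀ n, Measurable (X n)) :
    IsStoppingTime (observed X hX) (tauStar μ p q f0 f1 d X) := by
  intro n
  have hset : {ω | tauStar μ p q f0 f1 d X ω ≤ (n : ℕ∞)} =
      ⋃ k ∈ {k | k ≤ n ∧ d + 1 ≤ k}, reached μ p q f0 f1 d X k := by
    ext ω
    simp only [Set.mem_ofPred_eq, tauStar_le_iff, Set.mem_iUnion, exists_prop, and_assoc]
  change MeasurableSet[observed X hX n] {ω | tauStar μ p q f0 f1 d X ω ≤ (n : ℕ∞)}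
  rw [hset]
  refine MeasurableSet.biUnion (Set.to_countable _) fun k hk => ?_
  have hB : MeasurableSet {h : Fin (k + 1) → E | rStar μ p q f0 f1 d (lastStates d h) ≤
      statistic p q f0 f1 d (lastStates (d + 1) h)} :=
    measurableSet_le ((measurable_rStar hf0 hf1 hac hp d).comp (measurable_lastStates _ _))
      ((measurable_statistic hf0 hf1 d).comp (measurable_lastStates _ _))
  exact measurable_observed_history hX hk.1 hB

end TauStar

end DisorderDetection

theorem mainTheorem1 {E Ω : Type*} [MeasurableSpace E] [MeasurableSpace Ω]
    (P : Measure Ω) [IsProbabilityMeasure P] (μ : Measure E) [SigmaFinite μ]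
    (p q : ℝ≥0) (hp : 0 < p) (hq : 0 < q) (hpq : p + q = 1)
    (f0 f1 : E → E → ℝ≥0)
    (hf0 : DisorderDetection.IsTransitionDensity μ f0)
    (hf1 : DisorderDetection.IsTransitionDensity μ f1)
    (hac : ∀ y, ∀ᵐ z ∂μ, f0 y z = 0 → f1 y z = 0)
    (x : E) (θ : Ω → ℕ) (X : ℕ → Ω → E) (hX : ∀ n, Measurable (X n))
    (hmodel : DisorderDetection.IsSwitchedProcess P μ p q f0 f1 x θ X) (d : ℕ) :
    -- the thresholds converge, and the limit is finite wherever `L_0` does not vanish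
    (∀ w : Fin (d + 1) → E,
      Tendsto (fun k => DisorderDetection.threshold μ p q f0 f1 d k w) atTop
        (𝓝 (DisorderDetection.rStar μ p q f0 f1 d w)) ∧
      (DisorderDetection.L f0 f1 0 w ≠ 0 → DisorderDetection.rStar μ p q f0 f1 d w < ∞)) ∧
    -- (a) `τ*` is a stopping time and attains the supremum over all stopping times
    (IsStoppingTime (DisorderDetection.observed X hX)
        (DisorderDetection.tauStar μ p q f0 f1 d X) ∧
      P (DisorderDetection.detection d θ (DisorderDetection.tauStar μ p q f0 f1 d X)) =
        ⨆ (τ : Ω → ℕ∞) (_ : IsStoppingTime (DisorderDetection.observed X hX) τ),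
          P (DisorderDetection.detection d θ τ)) ∧
    -- (b) the optimal value
    P (DisorderDetection.detection d θ (DisorderDetection.tauStar μ p q f0 f1 d X)) =
      (p : ℝ≥0∞) ^ (d + 1) * ∫⁻ y : Fin (d + 1) → E,
        max (DisorderDetection.statistic p q f0 f1 d (Fin.cons (α := fun _ => E) x y))
            (DisorderDetection.rStar μ p q f0 f1 d y) *
          (DisorderDetection.L f0 f1 0 (Fin.cons (α := fun _ => E) x y) : ℝ≥0∞)
        ∂(Measure.pi fun _ => μ) := by
  open DisorderDetection in
  have hτs : IsStoppingTime (observed X hX) (tauStar μ p q f0 f1 d X) :=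
    isStoppingTime_tauStar hf0 hf1 hac hp hX
  have hval := measure_detection_eq hf0 hf1 hac hX hmodel hp hq hpq d hτs le_tauStar
    (fun n ω h => mem_reached_of_tauStar_eq h)
    (fun n ω hn h => (not_le.1 (notMem_reached_of_lt_tauStar hn h)).le)
  refine ⟨fun w => ⟨?_, rStar_lt_top hf0 hf1 hac hp hpq d⟩, ⟨hτs, le_antisymm ?_ ?_⟩, ?_⟩
  · rw [rStar_eq_iSup hf0 hf1 hac hp]
    exact tendsto_threshold hf0 hf1 hac hp d w
  · exact le_iSup₂_of_le (f := fun (τ : Ω → ℕ∞) (_ : IsStoppingTime (observed X hX) τ) =>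
      P (detection d θ τ)) _ hτs le_rfl
  · refine iSup₂_le fun τ hτ => ?_
    rw [hval]
    exact (measure_detection_le_max hf0 hf1 hX hmodel hq hpq d τ).trans
      (measure_detection_le hf0 hf1 hac hX hmodel hp hq hpq d (hτ.max_const (d + 1))
        fun ω => le_max_right _ _)
  · rw [hval, lintegral_history_lt hf0 hf1 hX hmodel hq hpq (d + 1)
      (measurable_value hf0 hf1 hac hp d (d + 1))]
    congr 1
    refine lintegral_congr fun y => ?_
    -- At time `d + 1` the window of `d + 2` states is the whole history, and dropping the starting
    -- state `x` leaves `y`.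
    rw [value, lastStates_self, ← tail_lastStates le_rfl, lastStates_self, Fin.tail_cons]
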